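/- Write $H^+=\{x+iy: x\ge 0\}$ and identify $z=x+iy\in H^+$ with $(x,y,0)\in\mathbb R^3$. Let $\sigma_t(x,y,\zeta)=(x\cos t-\zeta\sin t,\;y,\;x\sin t+\zeta\cos t)$ be the rotation about the $y$-axis, and for $A\subset H^+$ let $\Gamma(A)=\{\sigma_t(z): z\in A,\ 0\le t<2\pi\}$. For a set $B$ let $\mathcal M(B)$ be the set of Borel probability measures carried by $B$. For $B\subset\mathbb R^3$ compact and $\mu\in\mathcal M(B)$ let $I_0(\mu)=\iint\log\frac1{|p-q|}\,d\mu(p)\,d\mu(q)\in(-\infty,\infty]$ be the logarithmic energy, let $V_B=\inf_{\mu\in\mathcal M(B)}I_0(\mu)$, and let $\mathrm{cap}(B)=e^{-V_B}$ (so $\mathrm{cap}(\emptyset)=0$). A compact set $A\subset H^+$ is non-degenerate if $\mathrm{cap}(\Gamma(A))>0$. Let $$K(z,w)=\frac1{2\pi}\int_0^{2\pi}\log\frac1{|\sigma_t(z)-w|}\,dt\in(-\infty,\infty],\qquad J(\nu)=\iint K(z,w)\,d\nu(z)\,d\nu(w).$$ Let $A_+$ be the set of points $x_A(y)+iy$,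 where $y$ is in the projection of $A$ to the $y$-axis and $x_A(y)=\max\{x: x+iy\in A\}$. Suppose $A\subset H^+$ is non-degenerate and compact, and $A_+$ is contained in a vertical segment $[R+ci,R+di]$ for some $R>0$. Then there is a unique $\mu_{\Gamma(A)}\in\mathcal M(\Gamma(A))$ with $I_0(\mu_{\Gamma(A)})=V_{\Gamma(A)}$. The measure $\lambda_A$ given by $\lambda_A(B)=\mu_{\Gamma(A)}(\Gamma(B))$ for Borel $B\subset H^+$ is the unique measure in $\mathcal M(A)$ that minimizes $J$ over $\mathcal M(A)$, and $$\operatorname{supp}\lambda_A=A_+ .$$ -/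

import Mathlib

open MeasureTheory Set
open scoped ENNReal

noncomputable section

/-- The integral, with values in `[-∞, ∞]`, of an extended real valued function: the integral of
the positive part minus the integral of the negative part. It is the usual extended integral
whenever one of the two is finite, as is the case for a kernel that is bounded below
on the (compact) carrier of the measure. -/
def extIntegral {X : Type*} [MeasurableSpace X] (μ : Measure X) (f : X → EReal) : EReal :=
  ((∫⁻ x, (f x).toENNReal ∂μ : ℝ≥0∞) : EReal) - ((∫⁻ x, (-f x).toENNReal ∂μ : ℝ≥0∞) : EReal)

/-- `M(B)`: the Borel probability measures carried by the set `B`. -/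
def probMeasuresOn {X : Type*} [MeasurableSpace X] (B : Set X) : Set (Measure X) :=
  {μ | IsProbabilityMeasure μ ∧ μ Bᶜ = 0}

/-- The energy `∬ k(p, q) dμ(p) dμ(q)` of a measure for a kernel `k`. -/
def kernelEnergy {X : Type*} [MeasurableSpace X] (k : X → X → EReal) (μ : Measure X) : EReal :=
  extIntegral (μ.prod μ) (fun p => k p.1 p.2)

/-- The infimum of the energy over `M(B)` (it is `∞` for empty `B`). -/
def minEnergy {X : Type*} [MeasurableSpace X] (k : X → X → EReal) (B : Set X) : EReal :=
  ⨅ μ ∈ probMeasuresOn B, kernelEnergy k μ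

/-- `μ` is an equilibrium measure on `B` for the kernel `k`. -/
def IsEquilibriumMeasure {X : Type*} [MeasurableSpace X] (k : X → X → EReal) (B : Set X)
    (μ : Measure X) : Prop :=
  μ ∈ probMeasuresOn B ∧ kernelEnergy k μ = minEnergy k B

/-- Euclidean three-space, with coordinates `(x, y, ζ) = (p 0, p 1, p 2)`. -/
abbrev E3 : Type := EuclideanSpace ℝ (Fin 3)

/-- The logarithmic kernel `log (1 / |p - q|)`, equal to `+∞` for `p = q`. -/
def logKernel (p q : E3) : EReal := ENNReal.log (edist p q)⁻¹

/-- Logarithmic capacity of a compact set `B` in three-space: `exp (- V_B)`. -/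
def logCapacity (B : Set E3) : ℝ≥0∞ := EReal.exp (-minEnergy logKernel B)

/-- The closed right half-plane `H⁺`. -/
def rightHalfPlane : Set ℂ := {z | 0 ≤ z.re}

/-- The identification of `x + iy` with `(x, y, 0)`. -/
def embedPlane (z : ℂ) : E3 := !₂[z.re, z.im, 0]

/-- `σ_t`: the rotation about the `y`-axis through the angle `t`. -/
def rotY (t : ℝ) (p : E3) : E3 :=
  !₂[p 0 * Real.cos t - p 2 * Real.sin t, p 1, p 0 * Real.sin t + p 2 * Real.cos t]

/-- `Γ(A)`: the set obtained by revolving `A` around the `y`-axis. -/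
def revolve (A : Set ℂ) : Set E3 :=
  {p | ∃ z ∈ A, ∃ t ∈ Ico (0 : ℝ) (2 * Real.pi), p = rotY t (embedPlane z)}

/-- `A` is non-degenerate if `Γ(A)` has positive logarithmic capacity. -/
def NonDegenerate (A : Set ℂ) : Prop := 0 < logCapacity (revolve A)

/-- The uniform probability measure `dt / 2π` on `[0, 2π)`. -/
def angleMeasure : Measure ℝ :=
  (ENNReal.ofReal (2 * Real.pi))⁻¹ • volume.restrict (Ico (0 : ℝ) (2 * Real.pi))

/-- The kernel `K(z, w) = (1 / 2π) ∫₀^{2π} log (1 / |σ_t(z) - w|) dt`. -/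
def kernelK (z w : ℂ) : EReal :=
  extIntegral angleMeasure (fun t => logKernel (rotY t (embedPlane z)) (embedPlane w))

/-- The map of three-space onto `H⁺` whose fibres are the orbits of the rotations `σ_t`. -/
def profileMap (p : E3) : ℂ := ⟨Real.sqrt (p 0 ^ 2 + p 2 ^ 2), p 1⟩

open Classical in
/-- `μ_B`: the equilibrium measure on `B` for the logarithmic kernel
(the zero measure if there is none). -/
def logEquilibriumMeasure (B : Set E3) : Measure E3 :=
  if h : ∃ μ, IsEquilibriumMeasure logKernel B μ then h.choose else 0

/-- `λ_A`: the image of `μ_{Γ(A)}` on `H⁺`. By `lambdaMeasure_apply` below,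
`λ_A(B) = μ_{Γ(A)}(Γ(B))` for every Borel set `B ⊆ H⁺`. -/
def lambdaMeasure (A : Set ℂ) : Measure ℂ :=
  (logEquilibriumMeasure (revolve A)).map profileMap

/-- `A₊`: the right-most portion of `A`, that is, the points `x_A(y) + iy` where `y` is in the
projection of `A` to the `y`-axis and `x_A(y) = max {x | x + iy ∈ A}`. -/
def rightmost (A : Set ℂ) : Set ℂ :=
  {z | IsGreatest {x : ℝ | (⟨x, z.im⟩ : ℂ) ∈ A} z.re}

theorem measurable_profileMap : Measurable profileMap := by
  have h : profileMap = fun p : E3 =>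
      ((Real.sqrt (p 0 ^ 2 + p 2 ^ 2) : ℝ) : ℂ) + ((p 1 : ℝ) : ℂ) * Complex.I := by
    funext p
    apply Complex.ext <;> simp [profileMap]
  rw [h]
  exact Continuous.measurable (by fun_prop)

theorem preimage_profileMap {B : Set ℂ} (hB : B ⊆ rightHalfPlane) :
    profileMap ⁻¹' B = revolve B := by
  ext p
  constructor
  · intro hp
    refine ⟨profileMap p, hp, toIcoMod Real.two_pi_pos 0 (Complex.arg ⟨p 0, p 2⟩), ?_, ?_⟩
    · simpa using toIcoMod_mem_Ico Real.two_pi_pos 0 (Complex.arg ⟨p 0, p 2⟩)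
    · have hn : ‖(⟨p 0, p 2⟩ : ℂ)‖ = Real.sqrt (p 0 ^ 2 + p 2 ^ 2) := by
        rw [Complex.norm_def, Complex.normSq_mk, sq, sq]
      have h1 := Complex.norm_mul_cos_arg (⟨p 0, p 2⟩ : ℂ)
      have h2 := Complex.norm_mul_sin_arg (⟨p 0, p 2⟩ : ℂ)
      rw [hn] at h1 h2
      have hc : Real.cos (toIcoMod Real.two_pi_pos 0 (Complex.arg ⟨p 0, p 2⟩))
          = Real.cos (Complex.arg ⟨p 0, p 2⟩) := by
        rw [toIcoMod, zsmul_eq_mul, Real.cos_sub_int_mul_two_pi]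
      have hs : Real.sin (toIcoMod Real.two_pi_pos 0 (Complex.arg ⟨p 0, p 2⟩))
          = Real.sin (Complex.arg ⟨p 0, p 2⟩) := by
        rw [toIcoMod, zsmul_eq_mul, Real.sin_sub_int_mul_two_pi]
      ext i
      fin_cases i <;> simp [rotY, embedPlane, profileMap, hc, hs, h1, h2]
  · rintro ⟨z, hz, t, -, rfl⟩
    have h0 : 0 ≤ z.re := hB hz
    have h : profileMap (rotY t (embedPlane z)) = z := by
      apply Complex.ext
      · simp only [profileMap, rotY, embedPlane]
        simp [mul_pow, ← mul_add, Real.sqrt_sq h0]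
      · simp [profileMap, rotY, embedPlane]
    simpa [mem_preimage, h] using hz

theorem lambdaMeasure_apply (A : Set ℂ) {B : Set ℂ} (hB : MeasurableSet B)
    (hB' : B ⊆ rightHalfPlane) :
    lambdaMeasure A B = logEquilibriumMeasure (revolve A) (revolve B) := by
  rw [lambdaMeasure, Measure.map_apply measurable_profileMap hB, preimage_profileMap hB']

end

/-! A measure on $A$ is the profile of a rotation-invariant measure on $\Gamma(A)$, and $J$ of the
profile is the logarithmic energy $I$ of that revolved measure. One well-chosen profile $\lambda$ on
$A_+$ therefore settles both minimization problems.

The choice of $\lambda$: averaging the logarithm over a circle gives, for $w$ off the axis,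
$K(z,w)=-\log\rho(z,w)$ with $\rho$ half the sum of the distances from $w$ to $z$ and to its mirror
image (`revolvedKernel_eq`). For two points of the line $\mathrm{Re}=R$ at height difference $h$
this is a constant minus $\operatorname{arsinh}(|h|/2R)$: continuous even on the diagonal, strictly
decreasing and strictly convex in $|h|$. Let $\lambda$ minimize the energy on $A_+$. Its potential
is at least the energy $V$ on $A_+$, with equality on the support. Off the support, strict convexity
(in a gap) or strict monotonicity (beyond the ends) would push the potential below $V$, so the
support is all of $A_+$ (`exists_measure_potential_eq_of_strictConvexOn`). Moving $z$ left at fixed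
height does not increase $\rho$ (`focalRadius_le_focalRadius`), so the potential is at least $V$ on
all of $A$.

Minimality and uniqueness: $\log(D/|p-q|)$ is a mixture of Gaussians minus constants, and Gaussians
are positive definite by Fourier inversion. Hence $2I(\mu,\nu)\le I(\mu,\mu)+I(\nu,\nu)$ for
probability measures, and equality with finite $I(\mu,\nu)$ forces $\mu=\nu$
(`mutualEnergy_add_self_le`, `eq_of_mutualEnergy_le`). With $V\le I(\mu,\tilde\lambda)$ for the
revolved measure $\tilde\lambda$ this gives $V\le I(\mu,\mu)$, with equality only for
$\mu=\tilde\lambda$ (`mutualEnergy_minimal`). Here $D$ bounds all distances in $\Gamma(A)$, so that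
energies can be computed in $[0,\infty]$. -/

/-! ### Positive definiteness of the Gaussian kernel -/

section GaussianEnergy

open scoped RealInnerProductSpace ComplexConjugate

variable {V : Type*} [NormedAddCommGroup V] [InnerProductSpace ℝ V] [FiniteDimensional ℝ V]
  [MeasurableSpace V]

/-- The mutual energy of two measures for the Gaussian kernel. -/
noncomputable def gaussianEnergy (s : ℝ) (μ ν : Measure V) : ℝ :=
  ∫ p, Real.exp (-s * ‖p.1 - p.2‖ ^ 2) ∂(μ.prod ν)

theorem integral_cexp_inner_sub (μ ν : Measure V) [IsFiniteMeasure μ] [IsFiniteMeasure ν] (v : V) :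
    ∫ p : V × V, Complex.exp (Complex.I * (⟪p.1 - p.2, v⟫ : ℝ)) ∂(μ.prod ν)
      = charFun μ v * conj (charFun ν v) := by
  rw [charFun_apply, charFun_apply, ← integral_conj, ← integral_prod_mul]
  congr 1 with p
  rw [← Complex.exp_conj, ← Complex.exp_add]
  congr 1
  simp [inner_sub_left]
  ring

theorem gaussianEnergy_comm (s : ℝ) (μ ν : Measure V) [IsFiniteMeasure μ] [IsFiniteMeasure ν] :
    gaussianEnergy s μ ν = gaussianEnergy s ν μ := by
  rw [gaussianEnergy, gaussianEnergy, ← integral_prod_swap]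
  simp only [Prod.fst_swap, Prod.snd_swap, norm_sub_rev]

variable [BorelSpace V]

theorem integrable_cexp_neg_mul_sq_norm {b : ℝ} (hb : 0 < b) :
    Integrable (fun v : V => Complex.exp (-b * ‖v‖ ^ 2)) := by
  have := GaussianFourier.integrable_cexp_neg_mul_sq_norm_add (b := (b : ℂ)) (by simpa using hb)
    0 (0 : V)
  simpa using this

/-- The Gaussian of parameter $s$ is, up to a constant, the Fourier transform of the one of
parameter $1/(4s)$; Fubini then moves the integration over $\mu\times\nu$ inside, onto the
characters. -/
theorem gaussianEnergy_eq_integral {s : ℝ} (hs : 0 < s) (μ ν : Measure V) [IsFiniteMeasure μ]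
    [IsFiniteMeasure ν] :
    (Real.pi / (1 / (4 * s)) : ℂ) ^ (Module.finrank ℝ V / 2 : ℂ) * (gaussianEnergy s μ ν : ℂ) =
      ∫ v : V, Complex.exp (-(1 / (4 * s) : ℝ) * ‖v‖ ^ 2) *
        (charFun μ v * conj (charFun ν v)) := by
  have hb : (0 : ℝ) < 1 / (4 * s) := by positivity
  have hs' : (s : ℂ) ≠ 0 := by exact_mod_cast hs.ne'
  have key : ∀ p : V × V, (Real.pi / (1 / (4 * s)) : ℂ) ^ (Module.finrank ℝ V / 2 : ℂ) *
      (Real.exp (-s * ‖p.1 - p.2‖ ^ 2) : ℂ) =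
      ∫ v : V, Complex.exp (-(1 / (4 * s) : ℝ) * ‖v‖ ^ 2) *
        Complex.exp (Complex.I * (⟪p.1 - p.2, v⟫ : ℝ)) := by
    intro p
    have := GaussianFourier.integral_cexp_neg_mul_sq_norm_add (V := V)
      (b := ((1 / (4 * s) : ℝ) : ℂ)) (by rw [Complex.ofReal_re]; exact hb) Complex.I (p.1 - p.2)
    simp only [Complex.exp_add] at this
    rw [this]
    push_cast
    congr 2
    rw [Complex.I_sq]
    field_simp
  rw [gaussianEnergy, ← integral_complex_ofReal, ← integral_const_mul]
  simp_rw [key]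
  rw [integral_integral_swap]
  · congr 1 with v
    rw [integral_const_mul, integral_cexp_inner_sub]
  · have h1 : Integrable (fun z : (V × V) × V => (1 : ℂ) *
        Complex.exp (-(1 / (4 * s) : ℝ) * ‖z.2‖ ^ 2)) ((μ.prod ν).prod volume) :=
      Integrable.mul_prod (f := fun _ : V × V => (1 : ℂ)) (integrable_const _)
        (integrable_cexp_neg_mul_sq_norm hb)
    refine h1.mono (Continuous.aestronglyMeasurable (by simp only [Function.uncurry_def]; fun_prop)) ?_
    refine Filter.Eventually.of_forall fun z => ?_
    simp only [Function.uncurry, norm_mul, one_mul]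
    rw [mul_comm Complex.I, Complex.norm_exp_ofReal_mul_I, mul_one]

theorem continuous_charFun' (μ : Measure V) [IsFiniteMeasure μ] : Continuous (charFun μ) := by
  fun_prop

theorem integrable_gaussian_mul_charFun {b : ℝ} (hb : 0 < b) (μ ν : Measure V)
    [IsFiniteMeasure μ] [IsFiniteMeasure ν] :
    Integrable (fun v : V => Complex.exp (-b * ‖v‖ ^ 2) *
        (charFun μ v * conj (charFun ν v))) := by
  have hc := continuous_charFun' μ
  have hc' := continuous_charFun' ν
  refine (integrable_cexp_neg_mul_sq_norm hb).mul_bdd (c := μ.real univ * ν.real univ)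
    (Continuous.aestronglyMeasurable (by fun_prop)) (Filter.Eventually.of_forall fun v => ?_)
  rw [norm_mul, RCLike.norm_conj]
  exact mul_le_mul (norm_charFun_le _) (norm_charFun_le _) (norm_nonneg _) measureReal_nonneg

/-- This is the energy of the signed measure $\mu-\nu$, diagonalized by the Fourier transform. -/
theorem gaussianEnergy_sub_eq_integral {s : ℝ} (hs : 0 < s) (μ ν : Measure V) [IsFiniteMeasure μ]
    [IsFiniteMeasure ν] :
    (Real.pi / (1 / (4 * s))) ^ (Module.finrank ℝ V / 2 : ℝ) *
      (gaussianEnergy s μ μ + gaussianEnergy s ν ν - 2 * gaussianEnergy s μ ν) =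
      ∫ v : V, Real.exp (-(1 / (4 * s)) * ‖v‖ ^ 2) * ‖charFun μ v - charFun ν v‖ ^ 2 := by
  have hb : (0 : ℝ) < 1 / (4 * s) := by positivity
  have hm := gaussianEnergy_eq_integral hs μ μ
  have hn := gaussianEnergy_eq_integral hs ν ν
  have hmn := gaussianEnergy_eq_integral hs μ ν
  have hnm := gaussianEnergy_eq_integral hs ν μ
  rw [gaussianEnergy_comm s ν μ] at hnm
  rw [← Complex.ofReal_inj, ← integral_complex_ofReal]
  have hI := fun (α β : Measure V) [IsFiniteMeasure α] [IsFiniteMeasure β] =>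
    integrable_gaussian_mul_charFun hb α β
  -- The cross term appears twice so that one copy is expanded as $(\mu,\nu)$ and the other as
  -- $(\nu,\mu)$, matching the two conjugate cross terms of $|a-b|^2$.
  calc _ = (Real.pi / (1 / (4 * s)) : ℂ) ^ (Module.finrank ℝ V / 2 : ℂ) *
        (gaussianEnergy s μ μ : ℂ) +
        (Real.pi / (1 / (4 * s)) : ℂ) ^ (Module.finrank ℝ V / 2 : ℂ) * (gaussianEnergy s ν ν : ℂ)
        - (Real.pi / (1 / (4 * s)) : ℂ) ^ (Module.finrank ℝ V / 2 : ℂ) * (gaussianEnergy s μ ν : ℂ)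
        - (Real.pi / (1 / (4 * s)) : ℂ) ^ (Module.finrank ℝ V / 2 : ℂ) *
          (gaussianEnergy s μ ν : ℂ) := by
        rw [Complex.ofReal_mul, Complex.ofReal_cpow (by positivity)]
        push_cast
        ring
    _ = _ := by
      nth_rewrite 2 [hmn]
      rw [hm, hn, hnm, ← integral_add (hI _ _) (hI _ _), ← integral_sub _ (hI _ _),
        ← integral_sub _ (hI _ _)]
      · congr 1 with v
        rw [Complex.ofReal_mul, Complex.ofReal_pow, ← Complex.conj_mul', map_sub]
        push_cast
        ring
      · exact ((hI _ _).add (hI _ _)).sub (hI _ _)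
      · exact (hI _ _).add (hI _ _)

theorem two_mul_gaussianEnergy_le {s : ℝ} (hs : 0 < s) (μ ν : Measure V) [IsFiniteMeasure μ]
    [IsFiniteMeasure ν] :
    2 * gaussianEnergy s μ ν ≤ gaussianEnergy s μ μ + gaussianEnergy s ν ν := by
  have h := gaussianEnergy_sub_eq_integral hs μ ν
  have h0 : 0 ≤ ∫ v : V, Real.exp (-(1 / (4 * s)) * ‖v‖ ^ 2) * ‖charFun μ v - charFun ν v‖ ^ 2 :=
    integral_nonneg fun v => by positivity
  rw [← h] at h0
  have := nonneg_of_mul_nonneg_right h0 (by have := Real.pi_pos; positivity)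
  linarith

/-- The Gaussian weight vanishes nowhere, so a zero integral makes the continuous characteristic
functions agree everywhere. A single $s$ suffices. -/
theorem eq_of_gaussianEnergy_add_le {s : ℝ} (hs : 0 < s) {μ ν : Measure V} [IsFiniteMeasure μ]
    [IsFiniteMeasure ν]
    (heq : gaussianEnergy s μ μ + gaussianEnergy s ν ν ≤ 2 * gaussianEnergy s μ ν) : μ = ν := by
  have h := gaussianEnergy_sub_eq_integral hs μ ν
  have heq' := le_antisymm heq (two_mul_gaussianEnergy_le hs μ ν)
  rw [heq', sub_self, mul_zero] at h
  have hc := continuous_charFun' μ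
  have hc' := continuous_charFun' ν
  have hb : (0 : ℝ) < 1 / (4 * s) := by positivity
  have hint : Integrable fun v : V =>
      Real.exp (-(1 / (4 * s)) * ‖v‖ ^ 2) * ‖charFun μ v - charFun ν v‖ ^ 2 := by
    have h1 : Integrable fun v : V => Real.exp (-(1 / (4 * s)) * ‖v‖ ^ 2) := by
      refine ((integrable_cexp_neg_mul_sq_norm (V := V) hb).re).congr ?_
      refine Filter.Eventually.of_forall fun v => ?_
      have : Complex.exp (-(1 / (4 * s) : ℝ) * ‖v‖ ^ 2) =
        (Real.exp (-(1 / (4 * s)) * ‖v‖ ^ 2) : ℂ) := by push_cast; rfl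
      simp only [this]
      exact RCLike.ofReal_re _
    refine h1.mul_bdd (c := (μ.real univ + ν.real univ) ^ 2)
      (Continuous.aestronglyMeasurable (by fun_prop)) (Filter.Eventually.of_forall fun v => ?_)
    rw [Real.norm_of_nonneg (by positivity)]
    gcongr
    exact (norm_sub_le _ _).trans (add_le_add (norm_charFun_le _) (norm_charFun_le _))
  have h0 := (integral_eq_zero_iff_of_nonneg (fun v => by positivity) hint).1 h.symm
  have h1 := (Continuous.ae_eq_iff_eq (μ := (volume : Measure V)) (by fun_prop)
    continuous_const).1 h0
  refine Measure.ext_of_charFun (funext fun v => ?_)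
  have h2 := congrFun h1 v
  have h3 : ‖charFun μ v - charFun ν v‖ ^ 2 = 0 :=
    (mul_eq_zero.1 h2).resolve_left (Real.exp_pos _).ne'
  exact sub_eq_zero.1 (norm_eq_zero.1 (pow_eq_zero_iff two_ne_zero |>.1 h3))

end GaussianEnergy

/-! ### The logarithmic kernel as a mixture of Gaussians -/

section LogKernel

/-- The logarithmic kernel `log (D / |p - q|)`, which is nonnegative for points at distance
at most `D`. -/
noncomputable def shiftedLogKernel (D : ℝ) (p q : E3) : ℝ≥0∞ :=
  (logKernel p q + (Real.log D : ℝ)).toENNReal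

theorem logKernel_self (p : E3) : logKernel p p = ⊤ := by
  simp [logKernel]

theorem logKernel_of_ne {p q : E3} (h : p ≠ q) :
    logKernel p q = ((-Real.log (dist p q) : ℝ) : EReal) := by
  have hd : 0 < dist p q := dist_pos.2 h
  rw [logKernel, edist_dist, ← ENNReal.ofReal_inv_of_pos hd, ENNReal.log_ofReal_of_pos (by positivity),
    Real.log_inv]

theorem measurable_logKernel : Measurable fun p : E3 × E3 => logKernel p.1 p.2 := by
  unfold logKernel
  exact ENNReal.measurable_log.comp (measurable_edist.inv)

theorem Measurable.logKernel {α : Type*} [MeasurableSpace α] {f g : α → E3}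
    (hf : Measurable f) (hg : Measurable g) : Measurable fun x => logKernel (f x) (g x) := by
  have h := measurable_logKernel.comp (hf.prodMk hg)
  simpa only [Function.comp_def] using h

theorem measurable_shiftedLogKernel (D : ℝ) :
    Measurable fun p : E3 × E3 => shiftedLogKernel D p.1 p.2 := by
  unfold shiftedLogKernel
  exact measurable_ereal_toENNReal.comp (measurable_logKernel.add measurable_const)

theorem shiftedLogKernel_self (D : ℝ) (p : E3) : shiftedLogKernel D p p = ⊤ := by
  simp [shiftedLogKernel, logKernel_self]

theorem shiftedLogKernel_of_ne (D : ℝ) {p q : E3} (h : p ≠ q) :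
    shiftedLogKernel D p q = ENNReal.ofReal (Real.log D - Real.log (dist p q)) := by
  rw [shiftedLogKernel, logKernel_of_ne h, ← EReal.coe_add, EReal.toENNReal_of_ne_top
    (EReal.coe_ne_top _), EReal.toReal_coe]
  congr 1
  ring

theorem neg_log_le_logKernel {D : ℝ} {p q : E3} (h : dist p q ≤ D) :
    ((-Real.log D : ℝ) : EReal) ≤ logKernel p q := by
  rcases eq_or_ne p q with rfl | hpq
  · simp [logKernel_self]
  · rw [logKernel_of_ne hpq, EReal.coe_le_coe_iff]
    exact neg_le_neg (Real.log_le_log (dist_pos.2 hpq) h)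

theorem lintegral_exp_neg_mul {u : ℝ} (hu : 0 < u) :
    ∫⁻ s in Ioi (0 : ℝ), ENNReal.ofReal (Real.exp (-(s * u))) = ENNReal.ofReal u⁻¹ := by
  have h := integral_exp_mul_Ioi (a := -u) (by linarith) 0
  have hi := integrableOn_exp_mul_Ioi (a := -u) (by linarith) 0
  have he : ∀ s : ℝ, -u * s = -(s * u) := fun s => by ring
  simp only [he] at h hi
  rw [← ofReal_integral_eq_lintegral_ofReal hi
    (Filter.Eventually.of_forall fun s => (Real.exp_pos _).le), h]
  simp [div_eq_mul_inv, inv_neg]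

theorem lintegral_Ioc_exp_neg_mul {s a b : ℝ} (hs : 0 < s) (hab : a ≤ b) :
    ∫⁻ u in Ioc a b, ENNReal.ofReal (Real.exp (-(s * u))) =
      ENNReal.ofReal ((Real.exp (-(s * a)) - Real.exp (-(s * b))) / s) := by
  rw [← ofReal_integral_eq_lintegral_ofReal
    (Continuous.integrableOn_Ioc (by fun_prop))
    (Filter.Eventually.of_forall fun s => (Real.exp_pos _).le),
    ← intervalIntegral.integral_of_le hab]
  congr 1
  have he : ∀ u : ℝ, -(s * u) = (-s) * u := fun u => by ring
  simp only [he]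
  rw [intervalIntegral.integral_comp_mul_left (f := Real.exp) (c := -s) (by linarith [hs.ne']),
    integral_exp, smul_eq_mul]
  field_simp
  ring

/-- Write the quotient as $\int_a^b e^{-su}\,du$ and apply Tonelli. Leaving the right side as an
integral instead of $\log(b/a)$ admits $a=0$, which is needed on the diagonal. -/
theorem lintegral_frullani {a b : ℝ} (ha : 0 ≤ a) (hab : a ≤ b) :
    ∫⁻ s in Ioi (0 : ℝ), ENNReal.ofReal ((Real.exp (-(s * a)) - Real.exp (-(s * b))) / s) =
      ∫⁻ u in Ioc a b, ENNReal.ofReal u⁻¹ := by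
  rw [setLIntegral_congr_fun measurableSet_Ioi fun s hs => (lintegral_Ioc_exp_neg_mul hs hab).symm,
    lintegral_lintegral_swap]
  · exact setLIntegral_congr_fun measurableSet_Ioc fun u hu =>
      lintegral_exp_neg_mul (ha.trans_lt hu.1)
  · exact Measurable.aemeasurable (by simp only [Function.uncurry_def]; fun_prop)

/-- Frullani's integral between the squares $|p-q|^2$ and $D^2$; the squares account for the factor
2. -/
theorem two_mul_shiftedLogKernel {D : ℝ} (hD : 0 < D) {p q : E3} (h : dist p q ≤ D) :
    2 * shiftedLogKernel D p q = ∫⁻ s in Ioi (0 : ℝ), ENNReal.ofReal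
      ((Real.exp (-s * ‖p - q‖ ^ 2) - Real.exp (-s * D ^ 2)) / s) := by
  have hfr := lintegral_frullani (a := ‖p - q‖ ^ 2) (b := D ^ 2) (by positivity)
    (by rw [← dist_eq_norm]; gcongr)
  simp only [neg_mul]
  rw [hfr]
  have hu : 0 ≤ᵐ[volume.restrict (Ioc (‖p - q‖ ^ 2) (D ^ 2))] fun u : ℝ => u⁻¹ :=
    (ae_restrict_iff' measurableSet_Ioc).2 (Filter.Eventually.of_forall fun u hu =>
      inv_nonneg.2 ((sq_nonneg _).trans hu.1.le))
  have hle : ‖p - q‖ ^ 2 ≤ D ^ 2 := by rw [← dist_eq_norm]; gcongr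
  rcases eq_or_ne p q with rfl | hpq
  · rw [shiftedLogKernel_self]
    symm
    simp only [sub_self, norm_zero, ne_eq, OfNat.ofNat_ne_zero, not_false_eq_true, zero_pow] at *
    rw [ENNReal.mul_top (by simp)]
    -- On the diagonal both sides are infinite, because $1/u$ is not integrable at $0$.
    by_contra hne
    have h1 := (lintegral_ofReal_ne_top_iff_integrable
      (Measurable.aestronglyMeasurable (by fun_prop)) hu).1 hne
    have h2 := (intervalIntegrable_iff_integrableOn_Ioc_of_le (by positivity)).2 h1
    rcases intervalIntegrable_inv_iff.1 h2 with h3 | h3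
    · exact (pow_pos hD 2).ne h3
    · exact h3 left_mem_uIcc
  · have hd : 0 < ‖p - q‖ := norm_pos_iff.2 (sub_ne_zero.2 hpq)
    have h1 : IntervalIntegrable (fun u : ℝ => u⁻¹) volume (‖p - q‖ ^ 2) (D ^ 2) :=
      intervalIntegral.intervalIntegrable_inv (fun x hx => by
        rw [uIcc_of_le hle] at hx
        exact ((pow_pos hd 2).trans_le hx.1).ne') continuousOn_id
    rw [shiftedLogKernel_of_ne D hpq, ← ofReal_integral_eq_lintegral_ofReal
      ((intervalIntegrable_iff_integrableOn_Ioc_of_le hle).1 h1) hu,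
      ← intervalIntegral.integral_of_le hle, integral_inv_of_pos (by positivity) (by positivity),
      Real.log_div (by positivity) (by positivity), Real.log_pow, Real.log_pow, dist_eq_norm]
    have h2 := ENNReal.ofReal_mul (p := 2) (q := Real.log D - Real.log ‖p - q‖) zero_le_two
    rw [ENNReal.ofReal_ofNat] at h2
    rw [← h2]
    congr 1
    push_cast
    ring

/-- The mutual energy of two measures for the kernel `shiftedLogKernel D`. -/
noncomputable def mutualEnergy (D : ℝ) (μ ν : Measure E3) : ℝ≥0∞ :=
  ∫⁻ p, ∫⁻ q, shiftedLogKernel D p q ∂ν ∂μ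

theorem mutualEnergy_eq_lintegral_prod (D : ℝ) (μ ν : Measure E3) [SFinite ν] :
    mutualEnergy D μ ν = ∫⁻ p, shiftedLogKernel D p.1 p.2 ∂(μ.prod ν) :=
  (lintegral_prod _ (measurable_shiftedLogKernel D).aemeasurable).symm

variable {D : ℝ} {μ ν : Measure E3} [IsProbabilityMeasure μ] [IsProbabilityMeasure ν]

theorem integrable_exp_neg_mul_dist {s : ℝ} (hs : 0 < s) :
    Integrable (fun p : E3 × E3 => Real.exp (-s * ‖p.1 - p.2‖ ^ 2)) (μ.prod ν) := by
  refine (integrable_const (1 : ℝ)).mono (Continuous.aestronglyMeasurable (by fun_prop))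
    (Filter.Eventually.of_forall fun p => ?_)
  rw [Real.norm_of_nonneg (Real.exp_pos _).le, norm_one, Real.exp_le_one_iff]
  have := mul_nonneg hs.le (sq_nonneg ‖p.1 - p.2‖)
  linarith

/-- `ENNReal.ofReal` truncates negative numbers, so the nonnegativity is recorded too: it is what
allows sums to be taken inside `ENNReal.ofReal` later. -/
theorem ofReal_gaussianEnergy_sub {s : ℝ} (hs : 0 < s)
    (h : ∀ᵐ p ∂(μ.prod ν), dist p.1 p.2 ≤ D) :
    0 ≤ (gaussianEnergy s μ ν - Real.exp (-s * D ^ 2)) / s ∧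
    ENNReal.ofReal ((gaussianEnergy s μ ν - Real.exp (-s * D ^ 2)) / s) =
      ∫⁻ p, ENNReal.ofReal ((Real.exp (-s * ‖p.1 - p.2‖ ^ 2) - Real.exp (-s * D ^ 2)) / s)
        ∂(μ.prod ν) := by
  have hi := integrable_exp_neg_mul_dist (μ := μ) (ν := ν) hs
  have h0 : 0 ≤ᵐ[μ.prod ν] fun p : E3 × E3 =>
      (Real.exp (-s * ‖p.1 - p.2‖ ^ 2) - Real.exp (-s * D ^ 2)) / s := by
    filter_upwards [h] with p hp
    refine div_nonneg (sub_nonneg.2 (Real.exp_le_exp.2 ?_)) hs.le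
    rw [dist_eq_norm] at hp
    have : ‖p.1 - p.2‖ ^ 2 ≤ D ^ 2 := by gcongr
    nlinarith
  have he : (gaussianEnergy s μ ν - Real.exp (-s * D ^ 2)) / s =
      ∫ p, (Real.exp (-s * ‖p.1 - p.2‖ ^ 2) - Real.exp (-s * D ^ 2)) / s ∂(μ.prod ν) := by
    rw [integral_div, integral_sub hi (integrable_const _), integral_const, probReal_univ, one_smul,
      gaussianEnergy]
  refine ⟨he ▸ integral_nonneg_of_ae h0, ?_⟩
  rw [he]
  exact ofReal_integral_eq_lintegral_ofReal ((hi.sub (integrable_const _)).div_const s) h0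

theorem two_mul_mutualEnergy (hD : 0 < D) (h : ∀ᵐ p ∂(μ.prod ν), dist p.1 p.2 ≤ D) :
    2 * mutualEnergy D μ ν = ∫⁻ s in Ioi (0 : ℝ),
      ENNReal.ofReal ((gaussianEnergy s μ ν - Real.exp (-s * D ^ 2)) / s) := by
  rw [mutualEnergy_eq_lintegral_prod, ← lintegral_const_mul _ (measurable_shiftedLogKernel D)]
  rw [lintegral_congr_ae (h.mono fun p hp => two_mul_shiftedLogKernel hD hp)]
  rw [lintegral_lintegral_swap]
  · exact setLIntegral_congr_fun measurableSet_Ioi fun s hs =>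
      (ofReal_gaussianEnergy_sub hs h).2.symm
  · exact Measurable.aemeasurable (by simp only [Function.uncurry_def]; fun_prop)

theorem measurable_gaussianEnergy (μ ν : Measure E3) [SFinite μ] [SFinite ν] :
    Measurable fun s => gaussianEnergy s μ ν := by
  refine (StronglyMeasurable.integral_prod_right (f := fun (s : ℝ) (p : E3 × E3) =>
    Real.exp (-s * ‖p.1 - p.2‖ ^ 2)) ?_).measurable
  exact Continuous.stronglyMeasurable (by simp only [Function.uncurry_def]; fun_prop)

/-- Both measures have mass 1, so the subtracted constants cancel and only the Gaussian inequality
remains. -/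
theorem ofReal_gaussianEnergy_sub_le (hm : ∀ᵐ p ∂(μ.prod μ), dist p.1 p.2 ≤ D)
    (hn : ∀ᵐ p ∂(ν.prod ν), dist p.1 p.2 ≤ D) (hmn : ∀ᵐ p ∂(μ.prod ν), dist p.1 p.2 ≤ D)
    {s : ℝ} (hs : 0 < s) :
    ENNReal.ofReal ((gaussianEnergy s μ ν - Real.exp (-s * D ^ 2)) / s) +
      ENNReal.ofReal ((gaussianEnergy s μ ν - Real.exp (-s * D ^ 2)) / s) ≤
    ENNReal.ofReal ((gaussianEnergy s μ μ - Real.exp (-s * D ^ 2)) / s) +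
      ENNReal.ofReal ((gaussianEnergy s ν ν - Real.exp (-s * D ^ 2)) / s) := by
  have h := two_mul_gaussianEnergy_le hs μ ν
  have h1 := (ofReal_gaussianEnergy_sub hs hm).1
  have h2 := (ofReal_gaussianEnergy_sub hs hn).1
  have h3 := (ofReal_gaussianEnergy_sub hs hmn).1
  rw [← ENNReal.ofReal_add h3 h3, ← ENNReal.ofReal_add h1 h2]
  refine ENNReal.ofReal_le_ofReal ?_
  rw [← add_div, ← add_div]
  gcongr 1
  linarith

theorem mutualEnergy_add_self_le (hD : 0 < D) (hm : ∀ᵐ p ∂(μ.prod μ), dist p.1 p.2 ≤ D)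
    (hn : ∀ᵐ p ∂(ν.prod ν), dist p.1 p.2 ≤ D) (hmn : ∀ᵐ p ∂(μ.prod ν), dist p.1 p.2 ≤ D) :
    mutualEnergy D μ ν + mutualEnergy D μ ν ≤ mutualEnergy D μ μ + mutualEnergy D ν ν := by
  have h2 : (2 : ℝ≥0∞) ≠ 0 := by simp
  rw [← ENNReal.mul_le_mul_iff_right h2 (by simp), mul_add, mul_add, two_mul_mutualEnergy hD hm,
    two_mul_mutualEnergy hD hn, two_mul_mutualEnergy hD hmn]
  have hg := measurable_gaussianEnergy μ ν
  have hg' := measurable_gaussianEnergy μ μ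
  rw [← lintegral_add_left (by fun_prop), ← lintegral_add_left (by fun_prop)]
  exact setLIntegral_mono' measurableSet_Ioi fun s hs =>
    ofReal_gaussianEnergy_sub_le hm hn hmn hs

/-- Equality of finite integrals of ordered integrands gives equality of the integrands for almost
every $s$; one such $s>0$ is enough to identify the measures. -/
theorem eq_of_mutualEnergy_le (hD : 0 < D) (hm : ∀ᵐ p ∂(μ.prod μ), dist p.1 p.2 ≤ D)
    (hn : ∀ᵐ p ∂(ν.prod ν), dist p.1 p.2 ≤ D) (hmn : ∀ᵐ p ∂(μ.prod ν), dist p.1 p.2 ≤ D)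
    (hfin : mutualEnergy D μ ν ≠ ⊤)
    (hle : mutualEnergy D μ μ + mutualEnergy D ν ν ≤
      mutualEnergy D μ ν + mutualEnergy D μ ν) : μ = ν := by
  have h2 : (2 : ℝ≥0∞) ≠ 0 := by simp
  have hg := measurable_gaussianEnergy μ ν
  have hg' := measurable_gaussianEnergy μ μ
  have hg'' := measurable_gaussianEnergy ν ν
  have hle' := mul_le_mul_right hle 2
  have hfin' : 2 * (mutualEnergy D μ ν + mutualEnergy D μ ν) ≠ ⊤ :=
    ENNReal.mul_ne_top (by simp) (ENNReal.add_ne_top.2 ⟨hfin, hfin⟩)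
  rw [mul_add, mul_add, two_mul_mutualEnergy hD hm, two_mul_mutualEnergy hD hn,
    two_mul_mutualEnergy hD hmn, ← lintegral_add_left (by fun_prop),
    ← lintegral_add_left (by fun_prop)] at hle'
  rw [mul_add, two_mul_mutualEnergy hD hmn, ← lintegral_add_left (by fun_prop)] at hfin'
  have hae := ae_eq_of_ae_le_of_lintegral_le
    ((ae_restrict_iff' measurableSet_Ioi).2 (Filter.Eventually.of_forall fun s hs =>
      ofReal_gaussianEnergy_sub_le hm hn hmn hs)) hfin'
    (Measurable.aemeasurable (by fun_prop)) hle'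
  have hne : (ae (volume.restrict (Ioi (0 : ℝ)))).NeBot := by
    rw [ae_neBot, Ne, Measure.restrict_eq_zero]
    simp
  obtain ⟨s, hs, hs0 : 0 < s⟩ := (hae.and (ae_restrict_mem measurableSet_Ioi)).exists
  have h1 := (ofReal_gaussianEnergy_sub hs0 hm).1
  have h2 := (ofReal_gaussianEnergy_sub hs0 hn).1
  have h3 := (ofReal_gaussianEnergy_sub hs0 hmn).1
  refine eq_of_gaussianEnergy_add_le hs0 ?_
  simp only at hs
  rw [← ENNReal.ofReal_add h3 h3, ← ENNReal.ofReal_add h1 h2,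
    ENNReal.ofReal_eq_ofReal_iff (by positivity) (by positivity), ← add_div, ← add_div,
    div_left_inj' hs0.ne'] at hs
  linarith

end LogKernel

/-! ### Rotations about the axis -/

section Rotation

theorem continuous_rotY : Continuous fun p : ℝ × E3 => rotY p.1 p.2 := by
  unfold rotY
  refine (PiLp.continuous_toLp 2 _).comp (continuous_pi fun i => ?_)
  fin_cases i <;> simp <;> fun_prop

theorem continuous_embedPlane : Continuous embedPlane := by
  unfold embedPlane
  refine (PiLp.continuous_toLp 2 _).comp (continuous_pi fun i => ?_)
  fin_cases i <;> simp <;> fun_prop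

theorem rotY_rotY (s t : ℝ) (p : E3) : rotY s (rotY t p) = rotY (s + t) p := by
  ext i
  fin_cases i <;> simp [rotY, Real.cos_add, Real.sin_add] <;> ring

theorem dist_rotY (t : ℝ) (p q : E3) : dist (rotY t p) (rotY t q) = dist p q := by
  simp only [EuclideanSpace.dist_eq, Fin.sum_univ_three, Real.dist_eq, sq_abs]
  congr 1
  simp only [rotY, Fin.isValue, PiLp.toLp_apply, Matrix.cons_val]
  linear_combination ((p 0 - q 0) ^ 2 + (p 2 - q 2) ^ 2) * Real.sin_sq_add_cos_sq t

theorem dist_rotY_rotY (s t : ℝ) (p q : E3) :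
    dist (rotY s p) (rotY t q) = dist (rotY (s - t) p) q := by
  rw [← dist_rotY t (rotY (s - t) p), rotY_rotY, add_sub_cancel]

theorem rotY_periodic (p : E3) : Function.Periodic (fun t => rotY t p) (2 * Real.pi) := by
  intro t
  simp [rotY]

theorem exists_eq_rotY_profileMap (p : E3) : ∃ t, p = rotY t (embedPlane (profileMap p)) := by
  have h : p ∈ profileMap ⁻¹' {profileMap p} := rfl
  rw [preimage_profileMap (by rintro _ rfl; exact Real.sqrt_nonneg _)] at h
  obtain ⟨z, rfl, t, -, h⟩ := h
  exact ⟨t, h⟩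

theorem profileMap_rotY_embedPlane (t : ℝ) {z : ℂ} (hz : 0 ≤ z.re) :
    profileMap (rotY t (embedPlane z)) = z := by
  apply Complex.ext
  · simp only [profileMap, rotY, embedPlane]
    simp [mul_pow, ← mul_add, Real.sqrt_sq hz]
  · simp [profileMap, rotY, embedPlane]

theorem norm_rotY_embedPlane (t : ℝ) (z : ℂ) : ‖rotY t (embedPlane z)‖ = ‖z‖ := by
  have h0 : rotY t (0 : E3) = 0 := by
    ext i
    fin_cases i <;> simp [rotY]
  rw [← dist_zero_right, ← h0, dist_rotY, dist_zero_right, EuclideanSpace.norm_eq, Complex.norm_def]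
  congr 1
  simp only [embedPlane, Fin.sum_univ_three, Complex.normSq_apply]
  simp [sq]

instance : IsProbabilityMeasure angleMeasure := by
  constructor
  have h : 0 < 2 * Real.pi := Real.two_pi_pos
  rw [angleMeasure, Measure.smul_apply, Measure.restrict_apply_univ, Real.volume_Ico, sub_zero,
    smul_eq_mul, ENNReal.inv_mul_cancel (by simpa using h) ENNReal.ofReal_ne_top]

/-- A periodic function descends to the circle group, whose Haar measure is invariant under
translation and inversion. -/
theorem lintegral_angleMeasure_sub_left {f : ℝ → ℝ≥0∞} (hf : Function.Periodic f (2 * Real.pi))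
    (s : ℝ) : ∫⁻ t, f (s - t) ∂angleMeasure = ∫⁻ t, f t ∂angleMeasure := by
  have : Fact (0 < 2 * Real.pi) := ⟨Real.two_pi_pos⟩
  have key : ∀ g : AddCircle (2 * Real.pi) → ℝ≥0∞, ∫⁻ t, g t ∂angleMeasure =
      (ENNReal.ofReal (2 * Real.pi))⁻¹ * ∫⁻ t, g t := by
    intro g
    rw [angleMeasure, lintegral_smul_measure, smul_eq_mul, setLIntegral_congr Ico_ae_eq_Ioc,
      ← AddCircle.lintegral_preimage (2 * Real.pi) 0 g, zero_add]
  have h1 := key hf.lift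
  have h2 := key fun t => hf.lift (s - t)
  rw [lintegral_sub_left_eq_self hf.lift (s : AddCircle (2 * Real.pi))] at h2
  rw [← h1] at h2
  simpa only [← AddCircle.coe_sub, Function.Periodic.lift_coe] using h2

end Rotation

/-! ### The revolved kernel in closed form -/

section RevolvedKernel

/-- The average of the kernel `shiftedLogKernel D` over the rotations about the `y`-axis. -/
noncomputable def revolvedKernel (D : ℝ) (z w : ℂ) : ℝ≥0∞ :=
  ∫⁻ t, shiftedLogKernel D (rotY t (embedPlane z)) (embedPlane w) ∂angleMeasure

theorem shiftedLogKernel_congr {D : ℝ} {p q p' q' : E3} (h : dist p q = dist p' q') :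
    shiftedLogKernel D p q = shiftedLogKernel D p' q' := by
  simp [shiftedLogKernel, logKernel, edist_dist, h]

theorem Measurable.shiftedLogKernel {α : Type*} [MeasurableSpace α] {f g : α → E3}
    (hf : Measurable f) (hg : Measurable g) (D : ℝ) :
    Measurable fun x => shiftedLogKernel D (f x) (g x) := by
  have h := (measurable_shiftedLogKernel D).comp (hf.prodMk hg)
  simpa only [Function.comp_def] using h

theorem measurable_revolvedKernel (D : ℝ) :
    Measurable fun p : ℂ × ℂ => revolvedKernel D p.1 p.2 := by
  have h1 : Measurable fun x : (ℂ × ℂ) × ℝ => rotY x.2 (embedPlane x.1.1) :=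
    (continuous_rotY.comp (continuous_snd.prodMk
      (continuous_embedPlane.comp (continuous_fst.comp continuous_fst)))).measurable
  have h2 : Measurable fun x : (ℂ × ℂ) × ℝ => embedPlane x.1.2 :=
    (continuous_embedPlane.comp (continuous_snd.comp continuous_fst)).measurable
  exact (h1.shiftedLogKernel h2 D).lintegral_prod_right'

/-- The potential of a uniformly charged orbit is rotation invariant: if $p$ has angle $s$, only the
relative angle $s-t$ enters the distance. -/
theorem lintegral_shiftedLogKernel_rotY (D : ℝ) (p : E3) (w : ℂ) :
    ∫⁻ t, shiftedLogKernel D p (rotY t (embedPlane w)) ∂angleMeasure =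
      revolvedKernel D (profileMap p) w := by
  obtain ⟨s, hs⟩ := exists_eq_rotY_profileMap p
  have hper : Function.Periodic (fun t => shiftedLogKernel D
      (rotY t (embedPlane (profileMap p))) (embedPlane w)) (2 * Real.pi) := fun t => by
    simp only [rotY_periodic (embedPlane (profileMap p)) t]
  rw [revolvedKernel, ← lintegral_angleMeasure_sub_left hper s]
  refine lintegral_congr fun t => shiftedLogKernel_congr ?_
  rw [← dist_rotY_rotY, ← hs]

/-- The radius of the circle whose logarithmic potential is the revolved kernel: half the sum of
the distances of `w` from `z` and from its mirror image in the axis. -/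
noncomputable def focalRadius (z w : ℂ) : ℝ :=
  (Real.sqrt ((z.re + w.re) ^ 2 + (z.im - w.im) ^ 2) +
    Real.sqrt ((z.re - w.re) ^ 2 + (z.im - w.im) ^ 2)) / 2

theorem dist_rotY_embedPlane_sq (t : ℝ) (z w : ℂ) :
    dist (rotY t (embedPlane z)) (embedPlane w) ^ 2 =
      z.re ^ 2 + w.re ^ 2 + (z.im - w.im) ^ 2 - 2 * z.re * w.re * Real.cos t := by
  rw [EuclideanSpace.dist_eq, Real.sq_sqrt (Finset.sum_nonneg fun i _ => sq_nonneg _)]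
  simp only [Fin.sum_univ_three, Real.dist_eq, sq_abs, rotY, embedPlane]
  simp
  linear_combination z.re ^ 2 * Real.sin_sq_add_cos_sq t

/-- Both squared distances are affine in $\cos t$. They agree once radius plus centre is the
distance at $t=\pi$ and radius minus centre the distance at $t=0$, hence the half-sum and
half-difference. -/
theorem dist_rotY_embedPlane_eq_norm (t : ℝ) (z w : ℂ) :
    dist (rotY t (embedPlane z)) (embedPlane w) = ‖circleMap 0 (focalRadius z w) t -
      ((Real.sqrt ((z.re + w.re) ^ 2 + (z.im - w.im) ^ 2) -
        Real.sqrt ((z.re - w.re) ^ 2 + (z.im - w.im) ^ 2)) / 2 : ℝ)‖ := by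
  rw [← sq_eq_sq₀ dist_nonneg (norm_nonneg _), dist_rotY_embedPlane_sq, Complex.sq_norm,
    Complex.normSq_apply, focalRadius]
  have h1 := Real.sq_sqrt (by positivity : 0 ≤ (z.re + w.re) ^ 2 + (z.im - w.im) ^ 2)
  have h2 := Real.sq_sqrt (by positivity : 0 ≤ (z.re - w.re) ^ 2 + (z.im - w.im) ^ 2)
  set a := Real.sqrt ((z.re + w.re) ^ 2 + (z.im - w.im) ^ 2)
  set b := Real.sqrt ((z.re - w.re) ^ 2 + (z.im - w.im) ^ 2)
  have hre : (circleMap 0 ((a + b) / 2) t - ((a - b) / 2 : ℝ)).re =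
      (a + b) / 2 * Real.cos t - (a - b) / 2 := by
    simp [circleMap, Complex.exp_ofReal_mul_I_re, -Complex.ofReal_add, -Complex.ofReal_div,
      -Complex.ofReal_sub]
  have him : (circleMap 0 ((a + b) / 2) t - ((a - b) / 2 : ℝ)).im = (a + b) / 2 * Real.sin t := by
    simp [circleMap, Complex.exp_ofReal_mul_I_im, -Complex.ofReal_add, -Complex.ofReal_div,
      -Complex.ofReal_sub]
  rw [hre, him]
  linear_combination (-1 / 2 + Real.cos t / 2) * h1 + (-1 / 2 - Real.cos t / 2) * h2
    - (a + b) ^ 2 / 4 * Real.sin_sq_add_cos_sq t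

theorem focalRadius_pos {z w : ℂ} (hz : 0 ≤ z.re) (hw : 0 < w.re) : 0 < focalRadius z w := by
  unfold focalRadius
  have : 0 < (z.re + w.re) ^ 2 := by positivity
  positivity

/-- At a coincidence the kernel is $\infty$ while `Real.log 0` is $0$, so such angles must be null;
off the axis the only candidate is $t=0$. -/
theorem ae_angleMeasure_rotY_ne {z w : ℂ} (hz : 0 ≤ z.re) (hw : 0 < w.re) :
    ∀ᵐ t ∂angleMeasure, rotY t (embedPlane z) ≠ embedPlane w := by
  refine Measure.ae_smul_measure ?_ _
  have h0 : ∀ᵐ t : ℝ ∂(volume.restrict (Ico 0 (2 * Real.pi))), t ≠ 0 :=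
    ae_restrict_of_ae (Measure.ae_ne volume 0)
  filter_upwards [h0, ae_restrict_mem measurableSet_Ico] with t ht ht' h
  have e0 : z.re * Real.cos t = w.re := by simpa [rotY, embedPlane] using congrArg (fun p => p 0) h
  have e2 : z.re * Real.sin t = 0 := by simpa [rotY, embedPlane] using congrArg (fun p => p 2) h
  have hz' : 0 < z.re := by
    rcases hz.eq_or_lt with h' | h'
    · rw [← h', zero_mul] at e0
      exact absurd e0 hw.ne
    · exact h'
  have hs : Real.sin t = 0 := (mul_eq_zero.1 e2).resolve_left hz'.ne'
  have hc : 0 < Real.cos t := by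
    rw [← e0] at hw
    exact pos_of_mul_pos_right hw hz
  have hc1 : Real.cos t = 1 := by
    have := Real.sin_sq_add_cos_sq t
    rw [hs] at this
    nlinarith
  exact ht ((Real.cos_eq_one_iff_of_lt_of_lt (by linarith [ht'.1, Real.pi_pos]) ht'.2).1 hc1)

theorem integrable_angleMeasure_log_dist (z w : ℂ) :
    Integrable (fun t => Real.log (dist (rotY t (embedPlane z)) (embedPlane w))) angleMeasure := by
  refine Integrable.smul_measure ?_ (by simp [Real.pi_pos])
  have h := circleIntegrable_log_norm_sub_const (c := 0)
    (a := ((Real.sqrt ((z.re + w.re) ^ 2 + (z.im - w.im) ^ 2) -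
        Real.sqrt ((z.re - w.re) ^ 2 + (z.im - w.im) ^ 2)) / 2 : ℝ)) (focalRadius z w)
  rw [CircleIntegrable, intervalIntegrable_iff_integrableOn_Ico_of_le Real.two_pi_pos.le] at h
  simp only [dist_rotY_embedPlane_eq_norm]
  exact h

/-- The mean of $\log|\zeta-a|$ over the circle $|\zeta|=\rho$ is $\log\rho$ whenever $|a|\le\rho$.
The boundary case $|a|=\rho$ is included, which covers $z=w$. -/
theorem integral_angleMeasure_log_dist {z w : ℂ} (hz : 0 ≤ z.re) (hw : 0 < w.re) :
    ∫ t, Real.log (dist (rotY t (embedPlane z)) (embedPlane w)) ∂angleMeasure =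
      Real.log (focalRadius z w) := by
  have hp := focalRadius_pos hz hw
  have h := circleAverage_log_norm_sub_const_of_mem_closedBall (c := 0) (R := focalRadius z w)
    (a := ((Real.sqrt ((z.re + w.re) ^ 2 + (z.im - w.im) ^ 2) -
        Real.sqrt ((z.re - w.re) ^ 2 + (z.im - w.im) ^ 2)) / 2 : ℝ)) ?_
  · rw [← h, Real.circleAverage_def, intervalIntegral.integral_of_le Real.two_pi_pos.le,
      angleMeasure, integral_smul_measure, integral_Ico_eq_integral_Ioc,
      ENNReal.toReal_inv, ENNReal.toReal_ofReal Real.two_pi_pos.le]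
    simp only [dist_rotY_embedPlane_eq_norm]
  · rw [mem_closedBall_zero_iff, Complex.norm_real, Real.norm_eq_abs, abs_of_pos hp, focalRadius,
      abs_le]
    constructor <;> linarith [Real.sqrt_nonneg ((z.re + w.re) ^ 2 + (z.im - w.im) ^ 2),
      Real.sqrt_nonneg ((z.re - w.re) ^ 2 + (z.im - w.im) ^ 2)]

theorem revolvedKernel_eq {D : ℝ} {z w : ℂ} (hz : 0 ≤ z.re) (hw : 0 < w.re)
    (hD : ∀ t, dist (rotY t (embedPlane z)) (embedPlane w) ≤ D) :
    revolvedKernel D z w = ENNReal.ofReal (Real.log D - Real.log (focalRadius z w)) := by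
  have hae := ae_angleMeasure_rotY_ne hz hw
  have hi := integrable_angleMeasure_log_dist z w
  have h0 : 0 ≤ᵐ[angleMeasure] fun t =>
      Real.log D - Real.log (dist (rotY t (embedPlane z)) (embedPlane w)) := by
    filter_upwards [hae] with t ht
    exact sub_nonneg.2 (Real.log_le_log (dist_pos.2 ht) (hD t))
  have h1 := ofReal_integral_eq_lintegral_ofReal ((integrable_const (Real.log D)).sub hi) h0
  simp only [Pi.sub_apply] at h1
  rw [integral_sub (integrable_const _) hi, integral_const, probReal_univ, one_smul,
    integral_angleMeasure_log_dist hz hw] at h1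
  rw [h1, revolvedKernel]
  exact lintegral_congr_ae (hae.mono fun t ht => shiftedLogKernel_of_ne D ht)

/-- Convexity of $x\mapsto\sqrt{x^2+h^2}$ at the point $u$ of $[0,u+v]$, with denominators cleared.
-/
theorem mul_sqrt_add_sq_le {u v : ℝ} (hu : 0 ≤ u) (hv : 0 ≤ v) (h : ℝ) :
    (u + v) * Real.sqrt (u ^ 2 + h ^ 2) ≤ u * Real.sqrt ((u + v) ^ 2 + h ^ 2) + v * |h| := by
  have h1 := Real.sq_sqrt (by positivity : 0 ≤ u ^ 2 + h ^ 2)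
  have h2 := Real.sq_sqrt (by positivity : 0 ≤ (u + v) ^ 2 + h ^ 2)
  have h3 : |h| ≤ Real.sqrt ((u + v) ^ 2 + h ^ 2) :=
    Real.abs_le_sqrt (by nlinarith [sq_nonneg (u + v)])
  have h4 := sq_abs h
  set a := Real.sqrt (u ^ 2 + h ^ 2)
  set c := Real.sqrt ((u + v) ^ 2 + h ^ 2)
  refine le_of_sq_le_sq ?_ (by positivity)
  have h5 : 0 ≤ (u * v) * (|h| * (c - |h|)) :=
    mul_nonneg (mul_nonneg hu hv) (mul_nonneg (abs_nonneg h) (sub_nonneg.2 h3))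
  have e : (u * c + v * |h|) ^ 2 - ((u + v) * a) ^ 2 = 2 * ((u * v) * (|h| * (c - |h|))) := by
    linear_combination u ^ 2 * h2 + (v ^ 2 + 2 * u * v) * h4 - (u + v) ^ 2 * h1
  linarith

/-- The revolved kernel for a point `w` on the line `re = R` grows as the other point moves left
from this line. -/
theorem focalRadius_le_focalRadius {z w : ℂ} (hz : 0 ≤ z.re) (hzw : z.re ≤ w.re) (hw : 0 < w.re) :
    focalRadius z w ≤ focalRadius ⟨w.re, z.im⟩ w := by
  unfold focalRadius
  -- Both points $w_x\pm z_x$ lie in $[0,2w_x]$ and their weights at each endpoint sum to 1, so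
  -- adding the two inequalities gives the claim.
  have h1 := mul_sqrt_add_sq_le (u := w.re + z.re) (v := w.re - z.re) (by linarith) (by linarith)
    (z.im - w.im)
  have h2 := mul_sqrt_add_sq_le (u := w.re - z.re) (v := w.re + z.re) (by linarith) (by linarith)
    (z.im - w.im)
  have e1 : w.re + z.re + (w.re - z.re) = 2 * w.re := by ring
  have e2 : w.re - z.re + (w.re + z.re) = 2 * w.re := by ring
  rw [e1] at h1
  rw [e2] at h2
  have e3 : w.re + w.re = 2 * w.re := by ring
  have e4 : (z.re - w.re) ^ 2 = (w.re - z.re) ^ 2 := by ring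
  simp only [sub_self, e3, e4, add_comm z.re, ne_eq, OfNat.ofNat_ne_zero, not_false_eq_true,
    zero_pow, zero_add, Real.sqrt_sq_eq_abs]
  gcongr ?_ / 2
  refine le_of_mul_le_mul_left ?_ (by positivity : 0 < 2 * w.re)
  linarith

/-- Here $\rho=R\,(x+\sqrt{1+x^2})$ with $x=|h|/(2R)$. -/
theorem log_focalRadius_of_re_eq {z w : ℂ} (hzw : z.re = w.re) (hw : 0 < w.re) :
    Real.log (focalRadius z w) = Real.log w.re + Real.arsinh (|z.im - w.im| / (2 * w.re)) := by
  rw [Real.arsinh, ← Real.log_mul hw.ne' (by positivity), focalRadius, hzw]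
  congr 1
  have e : 1 + (|z.im - w.im| / (2 * w.re)) ^ 2 =
      ((w.re + w.re) ^ 2 + (z.im - w.im) ^ 2) / (2 * w.re) ^ 2 := by
    rw [div_pow, sq_abs]
    field_simp
    ring
  rw [e, Real.sqrt_div' _ (by positivity), Real.sqrt_sq (by positivity), sub_self, zero_pow two_ne_zero,
    zero_add, Real.sqrt_sq_eq_abs]
  field_simp
  ring

end RevolvedKernel

/-! ### Minimizers for continuous kernels -/

section Frostman

theorem integrable_of_continuous_compactSpace {X : Type*} [TopologicalSpace X]
    [CompactSpace X] [MeasurableSpace X] [OpensMeasurableSpace X] (f : X → ℝ) (hf : Continuous f) (μ : Measure X)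
    [IsFiniteMeasure μ] : Integrable f μ := by
  exact (BoundedContinuousFunction.mkOfCompact ⟨f, hf⟩).integrable μ

variable {X : Type*} [TopologicalSpace X] [CompactSpace X] [TopologicalSpace.MetrizableSpace X]
  [MeasurableSpace X] [BorelSpace X]

/-- Probability measures on a compact metrizable space are weakly compact, and
$\mu\mapsto\mu\times\mu$ is weakly continuous. -/
theorem exists_probabilityMeasure_energy_le [Nonempty X] {k : X → X → ℝ}
    (hk : Continuous (Function.uncurry k)) :
    ∃ μ : ProbabilityMeasure X, ∀ ν : ProbabilityMeasure X,
      ∫ p, k p.1 p.2 ∂((μ : Measure X).prod (μ : Measure X)) ≤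
        ∫ p, k p.1 p.2 ∂((ν : Measure X).prod (ν : Measure X)) := by
  have hne : Nonempty (ProbabilityMeasure X) := ⟨⟨Measure.dirac (Classical.arbitrary X), inferInstance⟩⟩
  let f : BoundedContinuousFunction (X × X) ℝ := BoundedContinuousFunction.mkOfCompact ⟨_, hk⟩
  have hc : Continuous fun μ : ProbabilityMeasure X =>
      ∫ p, f p ∂((μ.prod μ : ProbabilityMeasure (X × X)) : Measure (X × X)) := by
    have h1 : Continuous fun μ : ProbabilityMeasure X => μ.prod μ :=
      ProbabilityMeasure.continuous_prod.comp (continuous_id.prodMk continuous_id)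
    have h2 : Continuous fun μ : ProbabilityMeasure (X × X) => ∫ p, f p ∂(μ : Measure (X × X)) :=
      continuous_iff_continuousAt.2 fun μ =>
        ProbabilityMeasure.tendsto_iff_forall_integral_tendsto.1 Filter.tendsto_id f
    exact h2.comp h1
  obtain ⟨μ, -, hμ⟩ := isCompact_univ.exists_isMinOn univ_nonempty hc.continuousOn
  exact ⟨μ, fun ν => hμ (mem_univ ν)⟩

theorem continuous_potential {k : X → X → ℝ} (hk : Continuous (Function.uncurry k))
    (μ : Measure X) [IsFiniteMeasure μ] : Continuous fun x => ∫ y, k x y ∂μ := by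
  have := continuous_parametric_integral_of_continuous (μ := μ) hk isCompact_univ
  simpa using this

/-- **Frostman's inequality** for a continuous symmetric kernel on a compact space. -/
theorem exists_measure_energy_le_potential [Nonempty X] {k : X → X → ℝ}
    (hk : Continuous (Function.uncurry k)) (hsymm : ∀ x y, k x y = k y x) :
    ∃ μ : Measure X, IsProbabilityMeasure μ ∧ ∀ x, ∫ y, ∫ z, k y z ∂μ ∂μ ≤ ∫ y, k x y ∂μ := by
  obtain ⟨μ, hμ⟩ := exists_probabilityMeasure_energy_le hk
  have hi : ∀ (α β : Measure X) [IsFiniteMeasure α] [IsFiniteMeasure β],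
      Integrable (fun p : X × X => k p.1 p.2) (α.prod β) := fun α β _ _ =>
    integrable_of_continuous_compactSpace _ hk _
  refine ⟨μ, inferInstance, fun x => ?_⟩
  set U : X → ℝ := fun x => ∫ y, k x y ∂(μ : Measure X) with hU
  have hkx : ∀ x, Integrable (k x) (μ : Measure X) := fun x =>
    integrable_of_continuous_compactSpace _ (hk.comp (Continuous.prodMk_right x)) _
  have hUi : Integrable U (μ : Measure X) :=
    integrable_of_continuous_compactSpace _ (continuous_potential hk _) _
  set V : ℝ := ∫ y, U y ∂(μ : Measure X) with hV
  -- Compare $\mu$ with $(1-t)\mu+t\delta_x$: the energy is quadratic in $t$, and $\delta_x$ is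
  -- admissible because the continuous kernel is finite on the diagonal.
  have key : ∀ t : ℝ, 0 < t → t ≤ 1 →
      V ≤ (1 - t) ^ 2 * V + 2 * t * (1 - t) * U x + t ^ 2 * k x x := by
    intro t ht ht1
    let ν : Measure X := ENNReal.ofReal (1 - t) • (μ : Measure X) +
      ENNReal.ofReal t • Measure.dirac x
    have hν : IsProbabilityMeasure ν := by
      constructor
      simp only [ν, Measure.add_apply, Measure.smul_apply, measure_univ, smul_eq_mul, mul_one]
      rw [← ENNReal.ofReal_add (by linarith) ht.le]
      simp
    have h1 := hμ ⟨ν, hν⟩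
    simp only [ProbabilityMeasure.coe_mk] at h1
    rw [integral_prod _ (hi _ _), integral_prod _ (hi _ _)] at h1
    have hint : ∀ f : X → ℝ, Continuous f → ∫ y, f y ∂ν =
        (1 - t) * ∫ y, f y ∂(μ : Measure X) + t * f x := by
      intro f hf
      have hf' := fun (α : Measure X) [IsFiniteMeasure α] =>
        integrable_of_continuous_compactSpace f hf α
      rw [integral_add_measure ((hf' _).smul_measure (by simp)) ((hf' _).smul_measure (by simp)),
        integral_smul_measure, integral_smul_measure, integral_dirac,
        ENNReal.toReal_ofReal (by linarith), ENNReal.toReal_ofReal ht.le, smul_eq_mul, smul_eq_mul]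
    have h2 : ∀ y, ∫ z, k y z ∂ν = (1 - t) * U y + t * k y x := fun y =>
      hint _ (hk.comp (Continuous.prodMk_right y))
    rw [hint _ (continuous_potential hk ν)] at h1
    simp only [h2] at h1
    have hkx' : Integrable (fun y => k y x) (μ : Measure X) := by
      simpa only [hsymm _ x] using hkx x
    rw [integral_add (hUi.const_mul _) (hkx'.const_mul _), integral_const_mul,
      integral_const_mul] at h1
    have h3 : ∫ y, k y x ∂(μ : Measure X) = U x := by simp only [hsymm _ x, hU]
    rw [h3] at h1
    calc V ≤ _ := h1
      _ = _ := by ring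
  by_contra! hlt
  change U x < V at hlt
  have key' : ∀ t : ℝ, 0 < t → t ≤ 1 → 2 * (V - U x) ≤ t * (V - 2 * U x + k x x) := by
    intro t ht ht1
    have := key t ht ht1
    refine le_of_mul_le_mul_left ?_ ht
    nlinarith
  have hb : 0 < |V - 2 * U x + k x x| + 1 := by positivity
  -- This $t$ is small enough that the right side of `key'` is at most $V-U(x)$, half of its left
  -- side.
  have ht : 0 < min 1 ((V - U x) / (|V - 2 * U x + k x x| + 1)) :=
    lt_min one_pos (div_pos (by linarith) hb)
  have h1 := key' _ ht (min_le_left _ _)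
  have h2 : min 1 ((V - U x) / (|V - 2 * U x + k x x| + 1)) * (V - 2 * U x + k x x) ≤ V - U x := by
    calc _ ≤ min 1 ((V - U x) / (|V - 2 * U x + k x x| + 1)) * (|V - 2 * U x + k x x| + 1) :=
          mul_le_mul_of_nonneg_left ((le_abs_self _).trans (by linarith)) ht.le
      _ ≤ (V - U x) / (|V - 2 * U x + k x x| + 1) * (|V - 2 * U x + k x x| + 1) := by
          gcongr
          exact min_le_right _ _
      _ = V - U x := by field_simp
  linarith

end Frostman

/-! ### Full support for strictly convex decreasing kernels on the line -/

section ConvexKernel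

theorem integral_lt_integral_of_ae_lt {X : Type*} [MeasurableSpace X] {μ : Measure X} [NeZero μ]
    {f g : X → ℝ} (hf : Integrable f μ) (hg : Integrable g μ) (h : ∀ᵐ x ∂μ, f x < g x) :
    ∫ x, f x ∂μ < ∫ x, g x ∂μ := by
  rw [← sub_pos, ← integral_sub hg hf, integral_pos_iff_support_of_nonneg_ae
    (h.mono fun x hx => sub_nonneg.2 hx.le) (hg.sub hf), pos_iff_ne_zero]
  intro h0
  obtain ⟨x, hx, hx'⟩ := (h.and (measure_eq_zero_iff_ae_notMem.1 h0)).exists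
  exact hx' (sub_pos.2 hx).ne'

/-- For a strictly convex, strictly decreasing function of the distance on a compact subset of the
line, the equilibrium measure has full support. -/
theorem exists_measure_potential_eq_of_strictConvexOn {E : Set ℝ} (hE : IsCompact E)
    (hne : E.Nonempty) {g : ℝ → ℝ} (hg : Continuous g) (hanti : StrictAntiOn g (Ici 0))
    (hconv : StrictConvexOn ℝ (Ici 0) g) :
    ∃ (μ : Measure E) (V : ℝ), IsProbabilityMeasure μ ∧ μ.support = univ ∧
      ∀ x : E, ∫ y : E, g |(x : ℝ) - y| ∂μ = V := by
  have : CompactSpace E := isCompact_iff_compactSpace.1 hE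
  have : Nonempty E := hne.to_subtype
  have hk : Continuous (Function.uncurry fun x y : E => g |(x : ℝ) - y|) := by
    simp only [Function.uncurry_def]
    fun_prop
  obtain ⟨μ, hμ, hle⟩ := exists_measure_energy_le_potential hk fun x y => by rw [abs_sub_comm]
  set U : E → ℝ := fun x => ∫ y : E, g |(x : ℝ) - y| ∂μ with hU
  set V : ℝ := ∫ x, U x ∂μ with hV
  have hUc : Continuous U := continuous_potential hk μ
  -- The potential is at least $V$ and has mean $V$; continuity then carries the equality to the
  -- whole support.
  have hae : U =ᵐ[μ] fun _ => V := by
    have h0 : ∫ x, (U x - V) ∂μ = 0 := by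
      rw [integral_sub (integrable_of_continuous_compactSpace _ hUc _) (integrable_const _),
        integral_const, probReal_univ, one_smul, ← hV, sub_self]
    have h1 := (integral_eq_zero_iff_of_nonneg (fun x => sub_nonneg.2 (hle x))
      ((integrable_of_continuous_compactSpace _ hUc μ).sub (integrable_const _))).1 h0
    filter_upwards [h1] with x hx
    exact sub_eq_zero.1 hx
  have hsupp : ∀ x ∈ μ.support, U x = V := by
    have : μ.support ⊆ {x | U x = V} :=
      Measure.support_subset_of_isClosed (isClosed_eq hUc continuous_const) hae
    exact this
  have hS : IsCompact μ.support := Measure.isClosed_support.isCompact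
  have hSne : μ.support.Nonempty := Measure.nonempty_support (IsProbabilityMeasure.ne_zero μ)
  have hSae : ∀ᵐ y ∂μ, y ∈ μ.support := Measure.support_mem_ae
  have hint : ∀ x : E, Integrable (fun y : E => g |(x : ℝ) - y|) μ := fun x =>
    integrable_of_continuous_compactSpace _ (hk.comp (Continuous.prodMk_right x)) _
  have huniv : μ.support = univ := by
    refine eq_univ_of_forall fun x => ?_
    by_contra hx
    have hxV : V ≤ U x := hle x
    by_cases hl : (μ.support ∩ Iic x).Nonempty
    · obtain ⟨a, ⟨haS, hax⟩, ha⟩ := (hS.inter_right isClosed_Iic).exists_isGreatest hl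
      have hax' : (a : ℝ) < x := lt_of_le_of_ne hax fun h => hx (Subtype.ext h ▸ haS)
      by_cases hr : (μ.support ∩ Ici x).Nonempty
      · obtain ⟨b, ⟨hbS, hxb⟩, hb⟩ := (hS.inter_right isClosed_Ici).exists_isLeast hr
        have hxb' : (x : ℝ) < b := lt_of_le_of_ne hxb fun h => hx (Subtype.ext h ▸ hbS)
        have hba : 0 < (b : ℝ) - a := by linarith
        set s : ℝ := (b - x) / (b - a) with hs
        set t : ℝ := (x - a) / (b - a) with ht
        have hs0 : 0 < s := div_pos (by linarith) hba
        have ht0 : 0 < t := div_pos (by linarith) hba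
        have hst : s + t = 1 := by rw [hs, ht]; field_simp; ring
        have hx' : (x : ℝ) = s * a + t * b := by rw [hs, ht]; field_simp; ring
        -- No mass lies strictly between $a$ and $b$, so for each charged $y$ the function
        -- $g(|\cdot-y|)$ has its kink outside $(a,b)$ and is strictly convex on $[a,b]$.
        have hlt : U x < s * U a + t * U b := by
          have : s * U a + t * U b =
              ∫ y : E, (s * g |(a : ℝ) - y| + t * g |(b : ℝ) - y|) ∂μ := by
            rw [integral_add ((hint a).const_mul _) ((hint b).const_mul _), integral_const_mul,
              integral_const_mul]
          rw [this]
          refine integral_lt_integral_of_ae_lt (hint x)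
            (((hint a).const_mul _).add ((hint b).const_mul _)) ?_
          filter_upwards [hSae] with y hy
          rcases le_total y x with hyx | hyx
          · have hya : (y : ℝ) ≤ a := ha ⟨hy, hyx⟩
            rw [abs_of_nonneg (by linarith), abs_of_nonneg (by linarith),
              abs_of_nonneg (by linarith)]
            have h1 := hconv.2 (mem_Ici.2 (sub_nonneg.2 hya))
              (mem_Ici.2 (by linarith : (0 : ℝ) ≤ b - y)) (by intro h; linarith) hs0 ht0 hst
            simp only [smul_eq_mul] at h1
            refine lt_of_eq_of_lt ?_ h1
            congr 1
            rw [hx']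
            linear_combination (y : ℝ) * hst
          · have hby : (b : ℝ) ≤ y := hb ⟨hy, hyx⟩
            rw [abs_of_nonpos (by linarith), abs_of_nonpos (by linarith),
              abs_of_nonpos (by linarith)]
            have h1 := hconv.2 (mem_Ici.2 (by linarith : (0 : ℝ) ≤ -(a - y)))
              (mem_Ici.2 (by linarith : (0 : ℝ) ≤ -(b - y))) (by intro h; linarith) hs0 ht0 hst
            simp only [smul_eq_mul] at h1
            refine lt_of_eq_of_lt ?_ h1
            congr 1
            rw [hx']
            linear_combination (-(y : ℝ)) * hst
        rw [hsupp a haS, hsupp b hbS, ← add_mul, hst, one_mul] at hlt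
        exact absurd hxV hlt.not_ge
      -- Now $x$ lies to the right of the whole support, whose largest point is $a$; moving from $a$
      -- to $x$ increases every distance.
      · refine absurd hxV (not_le.2 ?_)
        rw [← hsupp a haS]
        refine integral_lt_integral_of_ae_lt (hint x) (hint a) ?_
        filter_upwards [hSae] with y hy
        have hyx : y ≤ x := by
          by_contra h
          exact hr ⟨y, hy, (not_le.1 h).le⟩
        have hya : (y : ℝ) ≤ a := ha ⟨hy, hyx⟩
        rw [abs_of_nonneg (by linarith), abs_of_nonneg (by linarith)]
        exact hanti (mem_Ici.2 (by linarith)) (mem_Ici.2 (by linarith)) (by linarith)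
    · obtain ⟨b, hbS, hb⟩ := hS.exists_isLeast hSne
      refine absurd hxV (not_le.2 ?_)
      rw [← hsupp b hbS]
      refine integral_lt_integral_of_ae_lt (hint x) (hint b) ?_
      have hxb : (x : ℝ) < b := by
        by_contra h
        exact hl ⟨b, hbS, not_lt.1 h⟩
      filter_upwards [hSae] with y hy
      have hby : (b : ℝ) ≤ y := hb hy
      rw [abs_of_nonpos (by linarith), abs_of_nonpos (by linarith)]
      exact hanti (mem_Ici.2 (by linarith)) (mem_Ici.2 (by linarith)) (by linarith)
  exact ⟨μ, V, hμ, huniv, fun x => hsupp x (huniv ▸ mem_univ x)⟩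

theorem strictConcaveOn_arsinh : StrictConcaveOn ℝ (Ici 0) Real.arsinh := by
  refine StrictAntiOn.strictConcaveOn_of_deriv (convex_Ici 0) Real.continuous_arsinh.continuousOn ?_
  rw [interior_Ici]
  intro x hx y hy hxy
  rw [(Real.hasDerivAt_arsinh x).deriv, (Real.hasDerivAt_arsinh y).deriv]
  have hx : 0 < x := hx
  gcongr

theorem strictConvexOn_const_sub_arsinh_div (C : ℝ) {r : ℝ} (hr : 0 < r) :
    StrictConvexOn ℝ (Ici 0) fun h => C - Real.arsinh (h / r) := by
  refine ⟨convex_Ici 0, fun x hx y hy hxy s t hs ht hst => ?_⟩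
  have h := strictConcaveOn_arsinh.2 (div_nonneg hx hr.le : 0 ≤ x / r) (div_nonneg hy hr.le : 0 ≤ y / r)
    (fun h => hxy (by field_simp at h; exact h)) hs ht hst
  simp only [smul_eq_mul] at h ⊢
  have e : (s * x + t * y) / r = s * (x / r) + t * (y / r) := by ring
  rw [e]
  have : s * C + t * C = C := by rw [← add_mul, hst, one_mul]
  linarith

theorem strictAntiOn_const_sub_arsinh_div (C : ℝ) {r : ℝ} (hr : 0 < r) :
    StrictAntiOn (fun h => C - Real.arsinh (h / r)) (Ici 0) := by
  intro x _ y _ hxy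
  have := Real.arsinh_lt_arsinh.2 ((div_lt_div_iff_of_pos_right hr).2 hxy)
  simp only
  linarith

end ConvexKernel

/-! ### Extended integrals of functions bounded below -/

section ExtIntegral

theorem extIntegral_congr_ae {X : Type*} [MeasurableSpace X] {μ : Measure X} {f g : X → EReal}
    (h : f =ᵐ[μ] g) : extIntegral μ f = extIntegral μ g := by
  unfold extIntegral
  have h1 : (fun x => (f x).toENNReal) =ᵐ[μ] fun x => (g x).toENNReal :=
    h.fun_comp EReal.toENNReal
  have h2 : (fun x => (-f x).toENNReal) =ᵐ[μ] fun x => (-g x).toENNReal :=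
    h.fun_comp fun a => (-a).toENNReal
  rw [lintegral_congr_ae h1, lintegral_congr_ae h2]

/-- The identity $a=a^+-a^-$, arranged without subtraction so that it survives $a=\infty$. -/
theorem EReal.toENNReal_add_ofReal {a : EReal} {c : ℝ} (hc : 0 ≤ c) (h : ((-c : ℝ) : EReal) ≤ a) :
    a.toENNReal + ENNReal.ofReal c = (a + c).toENNReal + (-a).toENNReal := by
  induction a with
  | bot => simp at h
  | top => simp
  | coe x =>
    rw [EReal.coe_le_coe_iff] at h
    rw [← EReal.coe_add, ← EReal.coe_neg, EReal.toENNReal_of_ne_top (EReal.coe_ne_top _),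
      EReal.toENNReal_of_ne_top (EReal.coe_ne_top _),
      EReal.toENNReal_of_ne_top (EReal.coe_ne_top _), EReal.toReal_coe, EReal.toReal_coe,
      EReal.toReal_coe]
    rcases le_total 0 x with hx | hx
    · rw [ENNReal.ofReal_of_nonpos (neg_nonpos.2 hx), add_zero, ENNReal.ofReal_add hx hc]
    · rw [ENNReal.ofReal_of_nonpos hx, zero_add, ← ENNReal.ofReal_add (by linarith) (by linarith)]
      congr 1
      ring

theorem EReal.coe_ennreal_sub_eq_of_add_eq {a b : ℝ≥0∞} {n c : ℝ} (hn : 0 ≤ n) (hc : 0 ≤ c)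
    (h : a + ENNReal.ofReal c = b + ENNReal.ofReal n) :
    (a : EReal) - (n : EReal) = (b : EReal) - (c : EReal) := by
  rcases eq_or_ne a ⊤ with rfl | ha
  · have hb : b = ⊤ := by
      by_contra hb
      rw [top_add] at h
      exact ENNReal.add_ne_top.2 ⟨hb, ENNReal.ofReal_ne_top⟩ h.symm
    rw [hb, EReal.coe_ennreal_top, EReal.top_sub_coe, EReal.top_sub_coe]
  · have hb : b ≠ ⊤ := by
      rintro rfl
      rw [top_add] at h
      exact ENNReal.add_ne_top.2 ⟨ha, ENNReal.ofReal_ne_top⟩ h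
    have h' := congrArg ENNReal.toReal h
    rw [ENNReal.toReal_add ha ENNReal.ofReal_ne_top, ENNReal.toReal_add hb ENNReal.ofReal_ne_top,
      ENNReal.toReal_ofReal hc, ENNReal.toReal_ofReal hn] at h'
    rw [← EReal.coe_ennreal_toReal ha, ← EReal.coe_ennreal_toReal hb, ← EReal.coe_sub,
      ← EReal.coe_sub, EReal.coe_eq_coe_iff]
    linarith

/-- The extended integral of a function that is bounded below, by way of the Lebesgue integral of
the nonnegative function obtained by adding a constant. -/
theorem extIntegral_eq_lintegral_sub {X : Type*} [MeasurableSpace X] {μ : Measure X}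
    [IsProbabilityMeasure μ] {f : X → EReal} (hf : Measurable f) {c : ℝ} (hc : 0 ≤ c)
    (h : ∀ᵐ x ∂μ, ((-c : ℝ) : EReal) ≤ f x) :
    extIntegral μ f = ((∫⁻ x, (f x + c).toENNReal ∂μ : ℝ≥0∞) : EReal) - (c : EReal) := by
  have hneg : ∫⁻ x, (-f x).toENNReal ∂μ ≤ ENNReal.ofReal c := by
    calc ∫⁻ x, (-f x).toENNReal ∂μ ≤ ∫⁻ _, ENNReal.ofReal c ∂μ := by
          refine lintegral_mono_ae (h.mono fun x hx => ?_)
          have h1 : -f x ≤ (c : EReal) := by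
            rw [EReal.neg_le, ← EReal.coe_neg]
            exact hx
          calc (-f x).toENNReal ≤ (c : EReal).toENNReal := EReal.toENNReal_le_toENNReal h1
            _ = ENNReal.ofReal c := by
              rw [EReal.toENNReal_of_ne_top (EReal.coe_ne_top _), EReal.toReal_coe]
      _ = ENNReal.ofReal c := by simp
  have hne : ∫⁻ x, (-f x).toENNReal ∂μ ≠ ⊤ := ne_top_of_le_ne_top ENNReal.ofReal_ne_top hneg
  have hsum : ∫⁻ x, (f x).toENNReal ∂μ + ENNReal.ofReal c =
      ∫⁻ x, (f x + c).toENNReal ∂μ + ∫⁻ x, (-f x).toENNReal ∂μ := by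
    have hm : Measurable fun x => (f x + c).toENNReal :=
      measurable_ereal_toENNReal.comp (hf.add measurable_const)
    rw [← lintegral_add_left hm,
      ← lintegral_congr_ae (h.mono fun x hx => EReal.toENNReal_add_ofReal hc hx),
      lintegral_add_right _ measurable_const]
    simp
  rw [← ENNReal.ofReal_toReal hne] at hsum
  rw [extIntegral, ← EReal.coe_ennreal_sub_eq_of_add_eq ENNReal.toReal_nonneg hc hsum,
    EReal.coe_ennreal_toReal hne]

theorem EReal.coe_ennreal_sub_le_iff {a b : ℝ≥0∞} (c : ℝ) :
    (a : EReal) - (c : EReal) ≤ (b : EReal) - (c : EReal) ↔ a ≤ b := by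
  rw [← EReal.coe_ennreal_le_coe_ennreal_iff]
  refine ⟨fun h => ?_, fun h => EReal.sub_le_sub h le_rfl⟩
  have h1 := add_le_add_left h (c : EReal)
  rwa [EReal.sub_add_cancel, EReal.sub_add_cancel] at h1

theorem isEquilibriumMeasure_iff_eq {X : Type*} [MeasurableSpace X] {k : X → X → EReal}
    {B : Set X} {μ₀ : Measure X} (h₀ : μ₀ ∈ probMeasuresOn B)
    (hle : ∀ μ ∈ probMeasuresOn B, kernelEnergy k μ₀ ≤ kernelEnergy k μ)
    (huniq : ∀ μ ∈ probMeasuresOn B, kernelEnergy k μ ≤ kernelEnergy k μ₀ → μ = μ₀)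
    (μ : Measure X) : IsEquilibriumMeasure k B μ ↔ μ = μ₀ := by
  have hmin : minEnergy k B = kernelEnergy k μ₀ :=
    le_antisymm (iInf₂_le μ₀ h₀) (le_iInf₂ hle)
  rw [IsEquilibriumMeasure, hmin]
  constructor
  · exact fun h => huniq μ h.1 h.2.le
  · rintro rfl
    exact ⟨h₀, rfl⟩

end ExtIntegral

/-! ### Rotation-invariant measures and their profiles -/

section RevolvedMeasure

/-- The rotation invariant measure in three-space with profile `ν`. -/
noncomputable def revolveMeasure (ν : Measure ℂ) : Measure E3 :=
  (angleMeasure.prod ν).map fun x => rotY x.1 (embedPlane x.2)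

theorem measurable_rotY_embedPlane : Measurable fun x : ℝ × ℂ => rotY x.1 (embedPlane x.2) :=
  (continuous_rotY.comp (continuous_fst.prodMk
    (continuous_embedPlane.comp continuous_snd))).measurable

instance (ν : Measure ℂ) [IsProbabilityMeasure ν] : IsProbabilityMeasure (revolveMeasure ν) :=
  Measure.isProbabilityMeasure_map measurable_rotY_embedPlane.aemeasurable

theorem map_profileMap_revolveMeasure {ν : Measure ℂ} [IsProbabilityMeasure ν]
    (hν : ∀ᵐ z ∂ν, 0 ≤ z.re) : (revolveMeasure ν).map profileMap = ν := by
  rw [revolveMeasure, Measure.map_map measurable_profileMap measurable_rotY_embedPlane]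
  have h : profileMap ∘ (fun x : ℝ × ℂ => rotY x.1 (embedPlane x.2)) =ᵐ[angleMeasure.prod ν]
      Prod.snd := by
    have := (Measure.quasiMeasurePreserving_snd (μ := angleMeasure) (ν := ν)).ae hν
    filter_upwards [this] with x hx
    exact profileMap_rotY_embedPlane x.1 hx
  rw [Measure.map_congr h, ← Measure.snd, Measure.snd_prod]

/-- Invariance of one factor is enough for the kernel to be averaged; $\mu$ is arbitrary, which lets
competitors without symmetry be treated. -/
theorem mutualEnergy_revolveMeasure (D : ℝ) (μ : Measure E3) (ν : Measure ℂ)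
    [IsProbabilityMeasure ν] : mutualEnergy D μ (revolveMeasure ν) =
      ∫⁻ p, ∫⁻ w, revolvedKernel D (profileMap p) w ∂ν ∂μ := by
  refine lintegral_congr fun p => ?_
  have hm : Measurable (shiftedLogKernel D p) := measurable_const.shiftedLogKernel measurable_id D
  rw [revolveMeasure, lintegral_map hm measurable_rotY_embedPlane]
  have hm' : Measurable fun x : ℝ × ℂ => shiftedLogKernel D p (rotY x.1 (embedPlane x.2)) :=
    measurable_const.shiftedLogKernel measurable_rotY_embedPlane D
  rw [lintegral_prod_symm' _ hm']
  exact lintegral_congr fun w => lintegral_shiftedLogKernel_rotY D p w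

theorem norm_eq_norm_profileMap (p : E3) : ‖p‖ = ‖profileMap p‖ := by
  obtain ⟨t, ht⟩ := exists_eq_rotY_profileMap p
  conv_lhs => rw [ht]
  exact norm_rotY_embedPlane t _

end RevolvedMeasure

/-! ### Equilibrium on a set of revolution -/

section SetsOfRevolution

variable {A : Set ℂ} {D : ℝ}

theorem ae_profileMap_mem (hAH : A ⊆ rightHalfPlane) {μ : Measure E3}
    (hμ : μ ∈ probMeasuresOn (revolve A)) : ∀ᵐ p ∂μ, profileMap p ∈ A := by
  have h := hμ.2
  rw [← preimage_profileMap hAH] at h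
  exact h

theorem revolveMeasure_mem_probMeasuresOn (hAH : A ⊆ rightHalfPlane) (hA : MeasurableSet A)
    {ν : Measure ℂ} (hν : ν ∈ probMeasuresOn A) :
    revolveMeasure ν ∈ probMeasuresOn (revolve A) := by
  have := hν.1
  have hae : ∀ᵐ z ∂ν, z ∈ A := hν.2
  refine ⟨inferInstance, ?_⟩
  rw [← preimage_profileMap hAH, ← preimage_compl,
    ← Measure.map_apply measurable_profileMap hA.compl,
    map_profileMap_revolveMeasure (hae.mono fun z hz => hAH hz)]
  exact hν.2

theorem dist_le_of_profileMap_mem (hD : ∀ z ∈ A, 2 * ‖z‖ ≤ D) {p q : E3} (hp : profileMap p ∈ A)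
    (hq : profileMap q ∈ A) : dist p q ≤ D := by
  have h := dist_le_norm_add_norm p q
  rw [norm_eq_norm_profileMap p, norm_eq_norm_profileMap q] at h
  linarith [hD _ hp, hD _ hq]

theorem ae_prod_dist_le (hAH : A ⊆ rightHalfPlane) (hD : ∀ z ∈ A, 2 * ‖z‖ ≤ D)
    {μ ν : Measure E3} (hμ : μ ∈ probMeasuresOn (revolve A)) (hν : ν ∈ probMeasuresOn (revolve A)) :
    ∀ᵐ p ∂(μ.prod ν), dist p.1 p.2 ≤ D := by
  have := hμ.1
  have := hν.1
  have h1 := (Measure.quasiMeasurePreserving_fst (μ := μ) (ν := ν)).ae (ae_profileMap_mem hAH hμ)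
  have h2 := (Measure.quasiMeasurePreserving_snd (μ := μ) (ν := ν)).ae (ae_profileMap_mem hAH hν)
  filter_upwards [h1, h2] with p hp hq
  exact dist_le_of_profileMap_mem hD hp hq

theorem dist_rotY_embedPlane_le (hD : ∀ z ∈ A, 2 * ‖z‖ ≤ D) {z w : ℂ} (hz : z ∈ A) (hw : w ∈ A)
    (t : ℝ) : dist (rotY t (embedPlane z)) (embedPlane w) ≤ D := by
  have h := dist_le_norm_add_norm (rotY t (embedPlane z)) (embedPlane w)
  have h0 := norm_rotY_embedPlane 0 w
  rw [show rotY 0 (embedPlane w) = embedPlane w by ext i; fin_cases i <;> simp [rotY]] at h0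
  rw [norm_rotY_embedPlane, h0] at h
  linarith [hD _ hz, hD _ hw]

theorem kernelEnergy_logKernel (hAH : A ⊆ rightHalfPlane) (hD1 : 1 ≤ D)
    (hD : ∀ z ∈ A, 2 * ‖z‖ ≤ D) {μ : Measure E3} (hμ : μ ∈ probMeasuresOn (revolve A)) :
    kernelEnergy logKernel μ = (mutualEnergy D μ μ : EReal) - (Real.log D : ℝ) := by
  have := hμ.1
  rw [kernelEnergy, extIntegral_eq_lintegral_sub measurable_logKernel (Real.log_nonneg hD1)
    ((ae_prod_dist_le hAH hD hμ hμ).mono fun p hp => neg_log_le_logKernel hp),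
    mutualEnergy_eq_lintegral_prod]
  rfl

theorem kernelK_eq (hD1 : 1 ≤ D) (hD : ∀ z ∈ A, 2 * ‖z‖ ≤ D) {z w : ℂ} (hz : z ∈ A) (hw : w ∈ A) :
    kernelK z w = (revolvedKernel D z w : EReal) - (Real.log D : ℝ) := by
  have hm : Measurable fun t => logKernel (rotY t (embedPlane z)) (embedPlane w) :=
    Measurable.logKernel (continuous_rotY.comp
      (Continuous.prodMk_left (embedPlane z))).measurable measurable_const
  rw [kernelK, extIntegral_eq_lintegral_sub hm (Real.log_nonneg hD1)
    (Filter.Eventually.of_forall fun t =>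
      neg_log_le_logKernel (dist_rotY_embedPlane_le hD hz hw t))]
  rfl

/-- This turns the planar problem into the spatial one restricted to rotation-invariant measures. -/
theorem kernelEnergy_kernelK (hAH : A ⊆ rightHalfPlane) (hD1 : 1 ≤ D)
    (hD : ∀ z ∈ A, 2 * ‖z‖ ≤ D) {ν : Measure ℂ} (hν : ν ∈ probMeasuresOn A) :
    kernelEnergy kernelK ν =
      (mutualEnergy D (revolveMeasure ν) (revolveMeasure ν) : EReal) - (Real.log D : ℝ) := by
  have := hν.1
  have hae : ∀ᵐ z ∂ν, z ∈ A := hν.2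
  have h1 := (Measure.quasiMeasurePreserving_fst (μ := ν) (ν := ν)).ae hae
  have h2 := (Measure.quasiMeasurePreserving_snd (μ := ν) (ν := ν)).ae hae
  have hm := measurable_revolvedKernel D
  have hK : (fun p : ℂ × ℂ => kernelK p.1 p.2) =ᵐ[ν.prod ν]
      fun p => (revolvedKernel D p.1 p.2 : EReal) - (Real.log D : ℝ) := by
    filter_upwards [h1, h2] with p hp hq
    exact kernelK_eq hD1 hD hp hq
  have hm' : Measurable fun p : ℂ × ℂ => (revolvedKernel D p.1 p.2 : EReal) - (Real.log D : ℝ) :=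
    hm.coe_ereal_ennreal.sub measurable_const
  have hE : mutualEnergy D (revolveMeasure ν) (revolveMeasure ν) =
      ∫⁻ p, revolvedKernel D p.1 p.2 ∂(ν.prod ν) := by
    rw [mutualEnergy_revolveMeasure, lintegral_prod _ hm.aemeasurable]
    conv_rhs => rw [← map_profileMap_revolveMeasure (hae.mono fun z hz => hAH hz)]
    rw [lintegral_map ?_ measurable_profileMap]
    · rw [map_profileMap_revolveMeasure (hae.mono fun z hz => hAH hz)]
    · exact hm.lintegral_prod_right'
  rw [kernelEnergy, extIntegral_congr_ae hK, extIntegral_eq_lintegral_sub hm'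
    (Real.log_nonneg hD1), hE]
  · simp only [EReal.sub_add_cancel, EReal.toENNReal_coe]
  · refine Filter.Eventually.of_forall fun p => ?_
    rw [sub_eq_add_neg, ← EReal.coe_neg]
    exact le_add_of_nonneg_left (EReal.coe_ennreal_nonneg _)

/-- A measure on the profile whose potential is at least its energy is the unique minimizer of
the energy. -/
theorem mutualEnergy_minimal (hAH : A ⊆ rightHalfPlane) (hA : MeasurableSet A) (hD1 : 1 ≤ D)
    (hD : ∀ z ∈ A, 2 * ‖z‖ ≤ D) {lam : Measure ℂ} (hlam : lam ∈ probMeasuresOn A) {V : ℝ≥0∞}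
    (hV : V ≠ ⊤) (hle : ∀ z ∈ A, V ≤ ∫⁻ w, revolvedKernel D z w ∂lam)
    (hself : mutualEnergy D (revolveMeasure lam) (revolveMeasure lam) = V)
    {μ : Measure E3} (hμ : μ ∈ probMeasuresOn (revolve A)) :
    V ≤ mutualEnergy D μ μ ∧ (mutualEnergy D μ μ ≤ V → μ = revolveMeasure lam) := by
  have hl := revolveMeasure_mem_probMeasuresOn hAH hA hlam
  have := hμ.1
  have := hlam.1
  have hD0 : 0 < D := by linarith
  have hm := ae_prod_dist_le hAH hD hμ hμ
  have hn := ae_prod_dist_le hAH hD hl hl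
  have hmn := ae_prod_dist_le hAH hD hμ hl
  have hVle : V ≤ mutualEnergy D μ (revolveMeasure lam) := by
    rw [mutualEnergy_revolveMeasure]
    calc V = ∫⁻ _, V ∂μ := by simp
      _ ≤ _ := lintegral_mono_ae ((ae_profileMap_mem hAH hμ).mono fun p hp => hle _ hp)
  -- The sandwich $2V\le 2I(\mu,\tilde\lambda)\le I(\mu,\mu)+V$ yields minimality, and its equality
  -- case yields uniqueness.
  have hpd := mutualEnergy_add_self_le hD0 hm hn hmn
  rw [hself] at hpd
  refine ⟨?_, fun hμV => ?_⟩
  · exact ENNReal.le_of_add_le_add_right hV ((add_le_add hVle hVle).trans hpd)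
  · have hfin : mutualEnergy D μ (revolveMeasure lam) ≠ ⊤ := by
      have h1 : mutualEnergy D μ (revolveMeasure lam) + mutualEnergy D μ (revolveMeasure lam) ≠ ⊤ :=
        ne_top_of_le_ne_top (ENNReal.add_ne_top.2 ⟨hV, hV⟩)
          (hpd.trans (add_le_add_left hμV V))
      exact (ENNReal.add_ne_top.1 h1).1
    refine eq_of_mutualEnergy_le hD0 hm hn hmn hfin ?_
    rw [hself]
    exact (add_le_add_left hμV V).trans (add_le_add hVle hVle)

/-- Nonemptiness is all that is needed of non-degeneracy: $A_+$ lies off the axis, where even a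
single circle has finite energy. -/
theorem NonDegenerate.nonempty (h : NonDegenerate A) : A.Nonempty := by
  rw [nonempty_iff_ne_empty]
  rintro rfl
  have h1 : revolve ∅ = ∅ := by simp [revolve]
  have h2 : minEnergy logKernel (∅ : Set E3) = ⊤ := by
    refine iInf₂_eq_top.2 fun μ hμ => ?_
    have := hμ.1
    have h3 := hμ.2
    simp at h3
  simp [NonDegenerate, logCapacity, h1, h2] at h

theorem exists_isGreatest_fibre (hAc : IsCompact A) {z : ℂ} (hz : z ∈ A) :
    ∃ x : ℝ, (⟨x, z.im⟩ : ℂ) ∈ rightmost A ∧ z.re ≤ x := by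
  have hc : IsCompact (Complex.re '' (A ∩ {w | w.im = z.im})) :=
    (hAc.inter_right (isClosed_eq Complex.continuous_im continuous_const)).image
      Complex.continuous_re
  have he : Complex.re '' (A ∩ {w | w.im = z.im}) = {x : ℝ | (⟨x, z.im⟩ : ℂ) ∈ A} := by
    ext x
    constructor
    · rintro ⟨w, ⟨hw, hwz : w.im = z.im⟩, rfl⟩
      simpa [← hwz] using hw
    · intro hx
      exact ⟨_, ⟨hx, rfl⟩, rfl⟩
  rw [he] at hc
  obtain ⟨x, hx⟩ := hc.exists_isGreatest ⟨z.re, hz⟩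
  exact ⟨x, hx, hx.2 hz⟩

theorem re_eq_of_mem_vertical_segment {R c d : ℝ} {z : ℂ}
    (hz : z ∈ segment ℝ (⟨R, c⟩ : ℂ) (⟨R, d⟩ : ℂ)) : z.re = R := by
  obtain ⟨a, b, -, -, hab, rfl⟩ := hz
  simp [← add_mul, hab]

/-- The radius is the mean of the distances at $t=\pi$ and $t=0$, the first being the larger. -/
theorem focalRadius_le {z w : ℂ} (hz : 0 ≤ z.re) (hw : 0 ≤ w.re)
    (hD : ∀ t, dist (rotY t (embedPlane z)) (embedPlane w) ≤ D) : focalRadius z w ≤ D := by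
  have h := hD Real.pi
  have h1 : dist (rotY Real.pi (embedPlane z)) (embedPlane w) =
      Real.sqrt ((z.re + w.re) ^ 2 + (z.im - w.im) ^ 2) := by
    rw [eq_comm, Real.sqrt_eq_iff_eq_sq (by positivity) dist_nonneg, dist_rotY_embedPlane_sq,
      Real.cos_pi]
    ring
  have h2 : Real.sqrt ((z.re - w.re) ^ 2 + (z.im - w.im) ^ 2) ≤
      Real.sqrt ((z.re + w.re) ^ 2 + (z.im - w.im) ^ 2) :=
    Real.sqrt_le_sqrt (by nlinarith [mul_nonneg hz hw])
  rw [h1] at h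
  unfold focalRadius
  linarith

/-- The equilibrium measure of the rightmost portion of the profile. -/
theorem exists_measure_rightmost (hAH : A ⊆ rightHalfPlane) (hAc : IsCompact A)
    (hne : A.Nonempty) {R : ℝ} (hR : 0 < R) (hre : ∀ z ∈ rightmost A, z.re = R)
    (hD : ∀ z ∈ A, 2 * ‖z‖ ≤ D) :
    ∃ (lam : Measure ℂ) (V : ℝ≥0∞), lam ∈ probMeasuresOn A ∧ lam.support = rightmost A ∧ V ≠ ⊤ ∧
      (∀ z ∈ A, V ≤ ∫⁻ w, revolvedKernel D z w ∂lam) ∧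
      mutualEnergy D (revolveMeasure lam) (revolveMeasure lam) = V := by
  have hmem : ∀ z ∈ rightmost A, z ∈ A := fun z hz => hz.1
  have hA : ∀ z ∈ A, z.re ≤ R ∧ (⟨R, z.im⟩ : ℂ) ∈ rightmost A := by
    intro z hz
    obtain ⟨x, hx, hzx⟩ := exists_isGreatest_fibre hAc hz
    obtain rfl : x = R := hre _ hx
    exact ⟨hzx, hx⟩
  -- $A$ and $A_+$ have the same projection `E`, so $A_+$ is a copy of this compact set on the line
  -- $\mathrm{Re}=R$.
  let E : Set ℝ := Complex.im '' A
  have hE : IsCompact E := hAc.image Complex.continuous_im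
  let g : ℝ → ℝ := fun h => (Real.log D - Real.log R) - Real.arsinh (h / (2 * R))
  have hg : Continuous g :=
    continuous_const.sub (Real.continuous_arsinh.comp (continuous_id.div_const _))
  obtain ⟨ν, V, hν, hsupp, hU⟩ := exists_measure_potential_eq_of_strictConvexOn hE (hne.image _) hg
    (strictAntiOn_const_sub_arsinh_div (Real.log D - Real.log R) (by positivity))
    (strictConvexOn_const_sub_arsinh_div (Real.log D - Real.log R) (by positivity))
  let ι : E → ℂ := fun y => ⟨R, y⟩
  have hι : Continuous ι := by
    have : ι = fun y : E => (R : ℂ) + ((y : ℝ) : ℂ) * Complex.I := by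
      funext y
      apply Complex.ext <;> simp [ι]
    rw [this]
    fun_prop
  have hιr : ∀ y, ι y ∈ rightmost A := by
    rintro ⟨_, z, hz, rfl⟩
    exact (hA z hz).2
  have hrange : rightmost A = range ι := by
    ext z
    constructor
    · intro hz
      exact ⟨⟨z.im, z, hmem z hz, rfl⟩, Complex.ext (hre z hz).symm rfl⟩
    · rintro ⟨y, rfl⟩
      exact hιr y
  have : CompactSpace E := isCompact_iff_compactSpace.1 hE
  have hclosed : IsClosed (rightmost A) := hrange ▸ (isCompact_range hι).isClosed
  have hlam0 : ν.map ι (rightmost A)ᶜ = 0 := by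
    rw [Measure.map_apply hι.measurable hclosed.measurableSet.compl, hrange]
    have : ι ⁻¹' (range ι)ᶜ = ∅ := by ext; simp
    rw [this, measure_empty]
  have hlam : ν.map ι ∈ probMeasuresOn A :=
    ⟨Measure.isProbabilityMeasure_map hι.measurable.aemeasurable,
      measure_mono_null (compl_subset_compl.2 hmem) hlam0⟩
  have hker : ∀ x y : E, revolvedKernel D (ι x) (ι y) = ENNReal.ofReal (g |(x : ℝ) - y|) ∧
      0 ≤ g |(x : ℝ) - y| := by
    intro x y
    have hxy := dist_rotY_embedPlane_le hD (hmem _ (hιr x)) (hmem _ (hιr y))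
    have hlog := log_focalRadius_of_re_eq (z := ι x) (w := ι y) rfl hR
    have hgeq : g |(x : ℝ) - y| = Real.log D - Real.log (focalRadius (ι x) (ι y)) := by
      rw [hlog]
      simp only [g, ι]
      ring
    rw [hgeq]
    exact ⟨revolvedKernel_eq hR.le hR hxy, sub_nonneg.2 (Real.log_le_log
      (focalRadius_pos hR.le hR) (focalRadius_le hR.le hR.le hxy))⟩
  have hpot : ∀ z ∈ rightmost A, ∫⁻ w, revolvedKernel D z w ∂(ν.map ι) = ENNReal.ofReal V := by
    intro z hz
    rw [hrange] at hz
    obtain ⟨x, rfl⟩ := hz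
    have hmeas : Measurable (revolvedKernel D (ι x)) := by
      have h := (measurable_revolvedKernel D).comp (measurable_prodMk_left (x := ι x))
      simpa only [Function.comp_def] using h
    have hint : Integrable (fun y : E => g |(x : ℝ) - y|) ν :=
      integrable_of_continuous_compactSpace _
        (hg.comp (continuous_const.sub continuous_subtype_val).abs) _
    rw [lintegral_map hmeas hι.measurable, ← hU x,
      ofReal_integral_eq_lintegral_ofReal hint
      (Filter.Eventually.of_forall fun y => (hker x y).2)]
    exact lintegral_congr fun y => (hker x y).1
  have hae : ∀ᵐ z ∂(ν.map ι), z ∈ rightmost A := hlam0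
  refine ⟨ν.map ι, ENNReal.ofReal V, hlam, ?_, ENNReal.ofReal_ne_top, ?_, ?_⟩
  · refine Subset.antisymm (Measure.support_subset_of_isClosed hclosed hae) ?_
    rw [hrange]
    rintro _ ⟨y, rfl⟩
    rw [Measure.mem_support_iff_forall]
    intro U hU
    have hy : y ∈ ν.support := hsupp ▸ mem_univ y
    exact ((Measure.mem_support_iff_forall y).1 hy _ (hι.continuousAt.preimage_mem_nhds hU)).trans_le
      (Measure.le_map_apply hι.measurable.aemeasurable U)
  · intro z hz
    -- Compare $z$ with the point of $A_+$ at the same height, where the potential equals $V$.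
    rw [← hpot _ (hA z hz).2]
    refine lintegral_mono_ae (hae.mono fun w hw => ?_)
    have hwR := hre w hw
    have hz0 : 0 ≤ z.re := hAH hz
    have hw0 : 0 < w.re := hwR ▸ hR
    rw [revolvedKernel_eq hz0 hw0 (dist_rotY_embedPlane_le hD hz (hmem w hw)),
      revolvedKernel_eq hR.le hw0 (dist_rotY_embedPlane_le hD (hmem _ (hA z hz).2) (hmem w hw))]
    refine ENNReal.ofReal_le_ofReal (sub_le_sub_left (Real.log_le_log (focalRadius_pos hz0 hw0) ?_) _)
    rw [← hwR]
    exact focalRadius_le_focalRadius hz0 (hwR ▸ (hA z hz).1) hw0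
  · have hp := hlam.1
    rw [mutualEnergy_revolveMeasure]
    have h1 : ∀ᵐ p ∂(revolveMeasure (ν.map ι)), profileMap p ∈ rightmost A := by
      have h2 : ∀ᵐ z ∂((revolveMeasure (ν.map ι)).map profileMap), z ∈ rightmost A := by
        rw [map_profileMap_revolveMeasure (hae.mono fun z hz => hAH (hmem z hz))]
        exact hae
      exact ae_of_ae_map measurable_profileMap.aemeasurable h2
    rw [lintegral_congr_ae (h1.mono fun p hp => hpot _ hp)]
    simp

end SetsOfRevolution

/-! ### The main theorem -/

theorem mainTheorem5 (A : Set ℂ) (hAH : A ⊆ rightHalfPlane) (hAc : IsCompact A)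
    (hA : NonDegenerate A) (R c d : ℝ) (hR : 0 < R)
    (hseg : rightmost A ⊆ segment ℝ (⟨R, c⟩ : ℂ) (⟨R, d⟩ : ℂ)) :
    (∃! μ : MeasureTheory.Measure E3, IsEquilibriumMeasure logKernel (revolve A) μ) ∧
    (∀ ν : MeasureTheory.Measure ℂ, IsEquilibriumMeasure kernelK A ν ↔ ν = lambdaMeasure A) ∧
    (lambdaMeasure A).support = rightmost A := by
  obtain ⟨M, hM⟩ := hAc.isBounded.exists_norm_le
  -- Twice the norm bound dominates all distances in $\Gamma(A)$; the added 1 makes $\log D\ge 0$.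
  let D : ℝ := 2 * |M| + 1
  have hD1 : 1 ≤ D := by simp [D]
  have hD : ∀ z ∈ A, 2 * ‖z‖ ≤ D := fun z hz => by
    have := (hM z hz).trans (le_abs_self M)
    simp only [D]
    linarith
  have hAm := hAc.measurableSet
  obtain ⟨lam, V, hlam, hsupp, hV, hle, hself⟩ := exists_measure_rightmost hAH hAc hA.nonempty hR
    (fun z hz => re_eq_of_mem_vertical_segment (hseg hz)) hD
  have hprob := hlam.1
  have hlift := revolveMeasure_mem_probMeasuresOn hAH hAm hlam
  have hmin := fun (μ : Measure E3) (hμ : μ ∈ probMeasuresOn (revolve A)) =>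
    mutualEnergy_minimal hAH hAm hD1 hD hlam hV hle hself hμ
  have hprofile : ∀ ν ∈ probMeasuresOn A, (revolveMeasure ν).map profileMap = ν := fun ν hν => by
    have := hν.1
    have hae : ∀ᵐ z ∂ν, z ∈ A := hν.2
    exact map_profileMap_revolveMeasure (hae.mono fun z hz => hAH hz)
  have hlog : ∀ μ, IsEquilibriumMeasure logKernel (revolve A) μ ↔ μ = revolveMeasure lam := by
    refine isEquilibriumMeasure_iff_eq hlift (fun μ hμ => ?_) (fun μ hμ h => ?_)
    · rw [kernelEnergy_logKernel hAH hD1 hD hlift, kernelEnergy_logKernel hAH hD1 hD hμ,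
        EReal.coe_ennreal_sub_le_iff, hself]
      exact (hmin μ hμ).1
    · rw [kernelEnergy_logKernel hAH hD1 hD hlift, kernelEnergy_logKernel hAH hD1 hD hμ,
        EReal.coe_ennreal_sub_le_iff, hself] at h
      exact (hmin μ hμ).2 h
  have hK : ∀ ν, IsEquilibriumMeasure kernelK A ν ↔ ν = lam := by
    refine isEquilibriumMeasure_iff_eq hlam (fun ν hν => ?_) (fun ν hν h => ?_)
    · rw [kernelEnergy_kernelK hAH hD1 hD hlam, kernelEnergy_kernelK hAH hD1 hD hν,
        EReal.coe_ennreal_sub_le_iff, hself]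
      exact (hmin _ (revolveMeasure_mem_probMeasuresOn hAH hAm hν)).1
    · rw [kernelEnergy_kernelK hAH hD1 hD hlam, kernelEnergy_kernelK hAH hD1 hD hν,
        EReal.coe_ennreal_sub_le_iff, hself] at h
      -- A measure on $A$ is recovered from its revolution, so uniqueness in space descends to
      -- profiles.
      rw [← hprofile ν hν, (hmin _ (revolveMeasure_mem_probMeasuresOn hAH hAm hν)).2 h,
        hprofile lam hlam]
  have hex : ∃ μ, IsEquilibriumMeasure logKernel (revolve A) μ := ⟨_, (hlog _).2 rfl⟩
  have hlambda : lambdaMeasure A = lam := by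
    -- `logEquilibriumMeasure` is an arbitrary choice of equilibrium measure; uniqueness identifies
    -- it.
    rw [lambdaMeasure, logEquilibriumMeasure, dif_pos hex, (hlog _).1 hex.choose_spec,
      hprofile lam hlam]
  rw [hlambda]
  exact ⟨⟨_, (hlog _).2 rfl, fun μ hμ => (hlog μ).1 hμ⟩, hK, hsupp⟩
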